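/- Let $p>3$ be a prime. For $r\ge 1$ and $k\ge 1$ put $O_k^{(r)}=\sum_{j=1}^{k}\frac{1}{(2j-1)^r}$ and $O_k=O_k^{(1)}$. Let $E_n$ denote the Euler numbers, given by $\frac{1}{\cosh t}=\sum_{n\ge 0}E_n\frac{t^n}{n!}$, and let $\Gamma_p:\mathbb{Z}_p\to\mathbb{Z}_p$ be Morita's $p$-adic Gamma function, i.e. the unique continuous function on $\mathbb{Z}_p$ with $\Gamma_p(n)=(-1)^n\prod_{0\le k<n,\ (k,p)=1}k$ for all integers $n\geq 0$. For $x,y\in\mathbb{Q}_p$ write $x\equiv y\pmod{p^m}$ if $x-y\in p^m\mathbb{Z}_p$. Then $$\sum_{k=1}^{p-1}\binom{2k}{k}^3\frac{O_k}{64^k}\equiv\begin{cases}0 \pmod{p^2}&\text{if } p\equiv 1\pmod 4,\\[1mm] -\dfrac{p}{12}\,\Gamma_p\!\left(\tfrac14\right)^4 \pmod{p^2}&\text{if } p\equiv 3\pmod 4,\end{cases}$$ and $$\sum_{k=1}^{p-1}\binom{2k}{k}^3\frac{O_k^{(2)}}{64^k}\equiv\begin{cases}\dfrac12\,\Gamma_p\!\left(\tfrac14\right)^4E_{p-3}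 \pmod{p}&\text{if } p\equiv 1\pmod 4,\\[1mm] -\dfrac1{16}\,\Gamma_p\!\left(\tfrac14\right)^4 \pmod{p}&\text{if } p\equiv 3\pmod 4.\end{cases}$$ -/

import Mathlib

open Filter Topology

/-- The generalized odd harmonic number `O_k^{(r)} = ∑_{j=1}^{k} 1 / (2j-1)^r`. -/
def oddHarmonic (r k : ℕ) : ℚ :=
  ∑ j ∈ Finset.Icc 1 k, 1 / (2 * (j : ℚ) - 1) ^ r

/-- The truncated sum `∑_{k=1}^{p-1} C(2k,k)^3 O_k^{(r)} / 64^k`. -/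
def truncatedSum (p r : ℕ) : ℚ :=
  ∑ k ∈ Finset.Icc 1 (p - 1), ((2 * k).choose k : ℚ) ^ 3 * oddHarmonic r k / 64 ^ k

/-- The formal power series `cosh t = ∑_{n even} t^n / n!`. -/
noncomputable def coshSeries : PowerSeries ℚ :=
  PowerSeries.mk fun n => if Even n then 1 / (n.factorial : ℚ) else 0

/-- The Euler numbers `E_n`, defined by `1 / cosh t = ∑ E_n t^n / n!`. -/
noncomputable def eulerNumber (n : ℕ) : ℚ :=
  (n.factorial : ℚ) * PowerSeries.coeff n coshSeries⁻¹

/-- The sequence `n ↦ (-1)^n ∏_{0 ≤ k < n, (k,p)=1} k`. -/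
def gammaSeq (p n : ℕ) : ℤ :=
  (-1) ^ n * ∏ k ∈ (Finset.range n).filter (fun k => k.Coprime p), (k : ℤ)

/-- Morita's `p`-adic Gamma function `Γ_p : ℤ_p → ℤ_p`: the extension by continuity of `gammaSeq p`,
that is, `Γ_p(x)` is the limit of `gammaSeq p n` as the natural number `n` tends to `x` in `ℤ_p`. -/
noncomputable def padicGamma (p : ℕ) [Fact p.Prime] (x : ℤ_[p]) : ℤ_[p] :=
  limUnder (comap (Nat.cast : ℕ → ℤ_[p]) (𝓝 x)) fun n : ℕ => (gammaSeq p n : ℤ_[p])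

/-- `x ≡ y (mod p^m)`: the difference lies in `p^m ℤ_p`. -/
def PadicCongr (p : ℕ) [Fact p.Prime] (m : ℕ) (x y : ℚ_[p]) : Prop :=
  ∃ z : ℤ_[p], x - y = (p : ℚ_[p]) ^ m * (z : ℚ_[p])

/-- `1/4` as a `p`-adic integer, for `p` odd. -/
theorem four_mul_inv_four (p : ℕ) [Fact p.Prime] (hp : p ≠ 2) :
    (4 : ℤ_[p]) * PadicInt.inv 4 = 1 := by
  apply PadicInt.mul_inv
  have h : IsUnit ((4 : ℕ) : ℤ_[p]) := by
    rw [PadicInt.isUnit_iff, PadicInt.norm_natCast_eq_one_iff]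
    have := (Nat.coprime_primes (Fact.out : p.Prime) Nat.prime_two).2 hp
    exact Nat.Coprime.pow_right 2 this
  exact PadicInt.isUnit_iff.1 (by exact_mod_cast h)

theorem gammaSeq_succ (p n : ℕ) :
    gammaSeq p (n + 1) = -gammaSeq p n * (if n.Coprime p then (n : ℤ) else 1) := by
  unfold gammaSeq
  rw [Finset.range_add_one, Finset.filter_insert]
  split_ifs with h
  · rw [Finset.prod_insert (by simp)]; ring
  · ring

/-- Wilson's theorem for an odd prime power. -/
theorem prod_units_primePow (p N : ℕ) [Fact p.Prime] (hp : p ≠ 2) (hN : N ≠ 0)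
    [Fintype (ZMod (p ^ N))ˣ] : ∏ x : (ZMod (p ^ N))ˣ, x = -1 := by
  classical
  have hpp : p.Prime := Fact.out
  have : IsCyclic (ZMod (p ^ N))ˣ := ZMod.isCyclic_units_of_prime_pow p hpp hp N
  have h2 : 2 < p ^ N := lt_of_lt_of_le (lt_of_le_of_ne hpp.two_le (Ne.symm hp))
    (Nat.le_self_pow hN p)
  have : Fact (2 < p ^ N) := ⟨h2⟩
  have hne : (-1 : (ZMod (p ^ N))ˣ) ≠ 1 := by
    intro h
    exact ZMod.neg_one_ne_one (congrArg Units.val h)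
  have hsub : ({1, -1} : Finset (ZMod (p ^ N))ˣ) =
      Finset.univ.filter (fun x : (ZMod (p ^ N))ˣ => x ^ 2 = 1) := by
    apply Finset.eq_of_subset_of_card_le
    · intro x hx
      simp only [Finset.mem_insert, Finset.mem_singleton] at hx
      rcases hx with rfl | rfl <;> simp
    · rw [Finset.card_pair hne.symm]
      exact IsCyclic.card_pow_eq_one_le (by norm_num)
  have key : ∀ x : (ZMod (p ^ N))ˣ, x⁻¹ = x → x = 1 ∨ x = -1 := by
    intro x hx
    have : x ∈ Finset.univ.filter (fun x : (ZMod (p ^ N))ˣ => x ^ 2 = 1) := by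
      simp only [Finset.mem_filter, Finset.mem_univ, true_and]
      rw [sq]; nth_rewrite 1 [← hx]; simp
    rw [← hsub] at this
    simpa using this
  have : (∏ x ∈ (Finset.univ : Finset (ZMod (p ^ N))ˣ).erase (-1), x) = 1 := by
    refine Finset.prod_involution (fun x _ => x⁻¹) (by simp) ?_ ?_ (by simp)
    · intro a ha h1 h2
      rcases key a h2 with h | h
      · exact h1 h
      · exact (Finset.mem_erase.1 ha).1 h
    · intro a ha
      simpa [inv_eq_iff_eq_inv] using ha
  rw [← Finset.insert_erase (Finset.mem_univ (-1 : (ZMod (p ^ N))ˣ)),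
    Finset.prod_insert (Finset.notMem_erase _ _), this, mul_one]

theorem gammaSeq_primePow (p N : ℕ) [Fact p.Prime] (hp : p ≠ 2) (hN : N ≠ 0) :
    ((gammaSeq p (p ^ N) : ℤ) : ZMod (p ^ N)) = 1 := by
  classical
  have hpp : p.Prime := Fact.out
  have : NeZero (p ^ N) := ⟨pow_ne_zero _ hpp.ne_zero⟩
  have hodd : Odd (p ^ N) := (hpp.odd_of_ne_two hp).pow
  have hW := congrArg Units.val (prod_units_primePow p N hp hN)
  rw [Units.coe_prod] at hW
  have : ∏ k ∈ (Finset.range (p ^ N)).filter (fun k => k.Coprime p), (k : ZMod (p ^ N))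
      = ∏ x : (ZMod (p ^ N))ˣ, (x : ZMod (p ^ N)) := by
    symm
    refine Finset.prod_bij (fun x _ => (x : ZMod (p ^ N)).val) ?_ ?_ ?_ ?_
    · intro x _
      simp only [Finset.mem_filter, Finset.mem_range]
      exact ⟨ZMod.val_lt _, (Nat.coprime_pow_right_iff (Nat.pos_of_ne_zero hN) _ _).1
        (ZMod.val_coe_unit_coprime x)⟩
    · intro x _ y _ h
      exact Units.ext (ZMod.val_injective _ h)
    · intro k hk
      simp only [Finset.mem_filter, Finset.mem_range] at hk
      refine ⟨ZMod.unitOfCoprime k (hk.2.pow_right N), Finset.mem_univ _, ?_⟩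
      simp [ZMod.val_natCast, Nat.mod_eq_of_lt hk.1]
    · intro x _
      simp
  unfold gammaSeq
  push_cast
  rw [this, hW, hodd.neg_one_pow]
  simp

theorem gammaSeq_add_primePow (p N n : ℕ) [Fact p.Prime] (hp : p ≠ 2) (hN : N ≠ 0) :
    ((gammaSeq p (n + p ^ N) : ℤ) : ZMod (p ^ N)) = gammaSeq p n := by
  induction n with
  | zero => simpa [gammaSeq] using gammaSeq_primePow p N hp hN
  | succ n ih =>
    have h : (n + p ^ N).Coprime p ↔ n.Coprime p := by
      obtain ⟨M, rfl⟩ := Nat.exists_eq_succ_of_ne_zero hN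
      rw [pow_succ, Nat.coprime_add_mul_right_left]
    rw [add_right_comm, gammaSeq_succ, gammaSeq_succ]
    simp only [h]
    have hz : (p : ZMod (p ^ N)) ^ N = 0 := by
      rw [← Nat.cast_pow]; exact ZMod.natCast_self _
    split_ifs <;> push_cast <;> rw [ih] <;> simp [hz]

/-- `gammaSeq p` is `p`-adically uniformly continuous for odd `p`. -/
theorem gammaSeq_modEq (p N m n : ℕ) [Fact p.Prime] (hp : p ≠ 2) (hN : N ≠ 0)
    (h : m ≡ n [MOD p ^ N]) :
    gammaSeq p m ≡ gammaSeq p n [ZMOD ((p ^ N : ℕ) : ℤ)] := by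
  have aux : ∀ a b : ℕ, ((gammaSeq p (a + p ^ N * b) : ℤ) : ZMod (p ^ N)) = gammaSeq p a := by
    intro a b
    induction b with
    | zero => simp
    | succ b ih => rw [mul_add, mul_one, ← add_assoc, gammaSeq_add_primePow p N _ hp hN, ih]
  rw [← ZMod.intCast_eq_intCast_iff, ← Nat.mod_add_div m (p ^ N), ← Nat.mod_add_div n (p ^ N),
    aux, aux, h]

/-- The limit that defines `Γ_p` exists, with the expected rate of convergence. -/
theorem norm_padicGamma_sub_le (p : ℕ) [Fact p.Prime] (hp : p ≠ 2) (N n : ℕ) (hN : N ≠ 0)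
    (x : ℤ_[p]) (h : ‖x - n‖ ≤ (p : ℝ) ^ (-N : ℤ)) :
    ‖padicGamma p x - gammaSeq p n‖ ≤ (p : ℝ) ^ (-N : ℤ) := by
  have hpp : p.Prime := Fact.out
  have hpos : ∀ M : ℕ, (0 : ℝ) < (p : ℝ) ^ (-M : ℤ) := fun M =>
    zpow_pos (by exact_mod_cast hpp.pos) _
  have near : ∀ M : ℕ, M ≠ 0 → ∀ a b : ℕ, ‖x - a‖ ≤ (p : ℝ) ^ (-M : ℤ) →
      ‖x - b‖ ≤ (p : ℝ) ^ (-M : ℤ) →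
      ‖(gammaSeq p a : ℤ_[p]) - gammaSeq p b‖ ≤ (p : ℝ) ^ (-M : ℤ) := by
    intro M hM a b ha hb
    have hab : ‖(((a : ℤ) - b : ℤ) : ℤ_[p])‖ ≤ (p : ℝ) ^ (-M : ℤ) := by
      have : (((a : ℤ) - b : ℤ) : ℤ_[p]) = (x - b) - (x - a) := by push_cast; ring
      rw [this, sub_eq_add_neg]
      refine (PadicInt.nonarchimedean _ _).trans (max_le hb ?_)
      rwa [norm_neg]
    rw [PadicInt.norm_int_le_pow_iff_dvd] at hab
    have hmod : b ≡ a [MOD p ^ M] := (Nat.modEq_iff_dvd).2 (by exact_mod_cast hab)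
    have := (gammaSeq_modEq p M b a hp hM hmod).dvd
    rw [← Int.cast_sub, PadicInt.norm_int_le_pow_iff_dvd]
    exact_mod_cast this
  have hball : ∀ M : ℕ, ∀ᶠ a : ℕ in comap (Nat.cast : ℕ → ℤ_[p]) (𝓝 x),
      ‖x - a‖ ≤ (p : ℝ) ^ (-M : ℤ) := by
    intro M
    refine mem_of_superset (preimage_mem_comap (Metric.closedBall_mem_nhds x (hpos M))) ?_
    intro a ha
    rw [Set.mem_preimage, mem_closedBall_iff_norm'] at ha
    exact ha
  have : (comap (Nat.cast : ℕ → ℤ_[p]) (𝓝 x)).NeBot :=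
    comap_neBot fun t ht => by
      obtain ⟨_, hy, a, rfl⟩ := mem_closure_iff_nhds.1 (PadicInt.denseRange_natCast x) t ht
      exact ⟨a, hy⟩
  have hcauchy : Cauchy (map (fun a : ℕ => (gammaSeq p a : ℤ_[p]))
      (comap (Nat.cast : ℕ → ℤ_[p]) (𝓝 x))) := by
    rw [Metric.cauchy_iff]
    refine ⟨inferInstance, fun ε hε => ?_⟩
    obtain ⟨M, hM⟩ := PadicInt.exists_pow_neg_lt p hε
    have hM' : (p : ℝ) ^ (-(M + 1 : ℕ) : ℤ) < ε := by
      refine lt_of_le_of_lt (zpow_le_zpow_right₀ (by exact_mod_cast hpp.one_lt.le) ?_) hM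
      push_cast; linarith
    refine ⟨_, image_mem_map (hball (M + 1)), ?_⟩
    rintro _ ⟨a, ha, rfl⟩ _ ⟨b, hb, rfl⟩
    rw [dist_eq_norm]
    exact (near (M + 1) (Nat.succ_ne_zero M) a b ha hb).trans_lt hM'
  have hlim : Tendsto (fun a : ℕ => (gammaSeq p a : ℤ_[p]))
      (comap (Nat.cast : ℕ → ℤ_[p]) (𝓝 x)) (𝓝 (padicGamma p x)) :=
    tendsto_nhds_limUnder (CompleteSpace.complete hcauchy)
  refine le_of_tendsto (hlim.sub_const _).norm ?_
  filter_upwards [hball N] with a ha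
  exact near N hN a n ha h

theorem padicGamma_natCast (p : ℕ) [Fact p.Prime] (hp : p ≠ 2) (n : ℕ) :
    padicGamma p n = gammaSeq p n := by
  rw [← sub_eq_zero, ← norm_le_zero_iff]
  refine le_of_forall_pos_le_add fun ε hε => ?_
  obtain ⟨M, hM⟩ := PadicInt.exists_pow_neg_lt p hε
  have hpp : p.Prime := Fact.out
  have h := norm_padicGamma_sub_le p hp (M + 1) n (Nat.succ_ne_zero M) n
    (by rw [sub_self, norm_zero]; exact (zpow_pos (by exact_mod_cast hpp.pos) _).le)
  rw [zero_add]
  refine h.trans ((zpow_le_zpow_right₀ (by exact_mod_cast hpp.one_lt.le) ?_).trans hM.le)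
  push_cast; linarith

theorem continuous_padicGamma (p : ℕ) [Fact p.Prime] (hp : p ≠ 2) :
    Continuous (padicGamma p) := by
  have hpp : p.Prime := Fact.out
  have hpos : ∀ M : ℕ, (0 : ℝ) < (p : ℝ) ^ (-M : ℤ) := fun M =>
    zpow_pos (by exact_mod_cast hpp.pos) _
  rw [Metric.continuous_iff]
  intro x ε hε
  obtain ⟨M, hM⟩ := PadicInt.exists_pow_neg_lt p hε
  have hM' : (p : ℝ) ^ (-(M + 1 : ℕ) : ℤ) < ε := by
    refine lt_of_le_of_lt (zpow_le_zpow_right₀ (by exact_mod_cast hpp.one_lt.le) ?_) hM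
    push_cast; linarith
  refine ⟨_, hpos (M + 1), fun y hy => ?_⟩
  obtain ⟨n, hn⟩ := PadicInt.denseRange_natCast.exists_dist_lt x (hpos (M + 1))
  rw [dist_eq_norm] at hn hy ⊢
  have hyn : ‖y - n‖ ≤ (p : ℝ) ^ (-(M + 1 : ℕ) : ℤ) := by
    rw [← sub_add_sub_cancel y x (n : ℤ_[p])]
    exact (PadicInt.nonarchimedean _ _).trans (max_le hy.le hn.le)
  have h1 := norm_padicGamma_sub_le p hp (M + 1) n (Nat.succ_ne_zero M) x hn.le
  have h2 := norm_padicGamma_sub_le p hp (M + 1) n (Nat.succ_ne_zero M) y hyn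
  rw [← sub_add_sub_cancel _ (gammaSeq p n : ℤ_[p]) _]
  refine ((PadicInt.nonarchimedean _ _).trans (max_le h2 ?_)).trans_lt hM'
  rw [← neg_sub, norm_neg]
  exact h1

/-! Put n = (p-1)/2 and c_k = C(2k,k)/4^k = (1/2)_k/k!, so that the summand is c_k^3 O_k^{(r)}. For
n < k < p the factor c_k^3 is divisible by p^3 while O_k^{(r)} has a pole of order r only, so the
sums may be cut at k = n (`padicCongr_truncatedSum`).

For O_k modulo p^2, take Dixon's well-poised summation with parameters a = 1/2, b = 1/2 + p/2 and -n
= 1/2 - p/2. Its terms are even in p factor by factor, hence are c_k^3 modulo p^2. Moving (a, b)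
along (1/2 + x, 1/2 + p/2 + 2x) and differentiating at x = 0 inserts the weight 6 O_k - 4p O_k^{(2)}
+ p H_k^{(2)}, where H_k^{(2)} = ∑_{j≤k} 1/j^2. The closed form then yields 6 ∑ c_k^3 O_k modulo
p^2, up to p times sums needed only modulo p (`padicCongr_six_mul_sum`).

For those sums, take Whipple's ₃F₂(-n, n+1, 1/2; 1+√e, 1-√e; 1). Modulo p both -n and n+1 are 1/2,
so at e = 0 the terms are c_k^3, and the derivative in e inserts H_k^{(2)}. The reflection k ↦ n-k,
under which c_{n-k} ≡ (-1)^n c_k and 4 O_k^{(2)} ≡ -H_{n-k}^{(2)}, converts H^{(2)} into O^{(2)}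
(`sum_centralRatio_mul_oddSum_zmod`).

What remains is to name the residues. If p = 4m+1, the answers involve c_m^2 ≡ -Γ_p(1/4)^4 and
H_m^{(2)} ≡ 4 E_{p-3}; if p = 4m+3, only m!^4 ≡ Γ_p(1/4)^4. The Gamma values come from Wilson's
theorem, and the Euler number from an alternating power sum modulo p that obeys the Euler recurrence
(`reduces_eulerNumber`). The two classes differ in where p occurs in Dixon's closed form: for p =
4m+1 its value is a p-adic unit and the poles of its logarithmic derivative cancel; for p = 4m+3 its
value carries p^2 against a pole 8/p. -/

/-! ### Reduction modulo p and congruences in ℚ_p -/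

section Calculus

variable {p : ℕ} [Fact p.Prime]

/-- `x ∈ ℤ_p` and its reduction modulo `p` is `y`. -/
def Reduces (x : ℚ_[p]) (y : ZMod p) : Prop :=
  ∃ z : ℤ_[p], (z : ℚ_[p]) = x ∧ PadicInt.toZMod z = y

namespace Reduces

variable {x x' : ℚ_[p]} {y y' : ZMod p}

theorem add (h : Reduces x y) (h' : Reduces x' y') : Reduces (x + x') (y + y') := by
  obtain ⟨z, rfl, rfl⟩ := h
  obtain ⟨w, rfl, rfl⟩ := h'
  exact ⟨z + w, by simp, by simp⟩

theorem neg (h : Reduces x y) : Reduces (-x) (-y) := by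
  obtain ⟨z, rfl, rfl⟩ := h
  exact ⟨-z, by simp, by simp⟩

theorem sub (h : Reduces x y) (h' : Reduces x' y') : Reduces (x - x') (y - y') := by
  rw [sub_eq_add_neg, sub_eq_add_neg]; exact h.add h'.neg

theorem mul (h : Reduces x y) (h' : Reduces x' y') : Reduces (x * x') (y * y') := by
  obtain ⟨z, rfl, rfl⟩ := h
  obtain ⟨w, rfl, rfl⟩ := h'
  exact ⟨z * w, by simp, by simp⟩

theorem pow (h : Reduces x y) (n : ℕ) : Reduces (x ^ n) (y ^ n) := by
  obtain ⟨z, rfl, rfl⟩ := h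
  exact ⟨z ^ n, by simp, by simp⟩

theorem natCast (n : ℕ) : Reduces (n : ℚ_[p]) (n : ZMod p) := ⟨n, by simp, by simp⟩

theorem one : Reduces (1 : ℚ_[p]) 1 := ⟨1, by simp, by simp⟩

theorem zero : Reduces (0 : ℚ_[p]) 0 := ⟨0, by simp, by simp⟩

theorem ofNat (n : ℕ) [n.AtLeastTwo] :
    Reduces (OfNat.ofNat n : ℚ_[p]) (OfNat.ofNat n : ZMod p) := by
  exact_mod_cast natCast (p := p) n

theorem intCast (n : ℤ) : Reduces (n : ℚ_[p]) (n : ZMod p) := ⟨n, by simp, by simp⟩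

/-- A nonzero residue makes the p-adic integer a unit. Through this lemma, integrality of every
fraction below is settled by a nonvanishing check in `ZMod p`. -/
theorem inv (h : Reduces x y) (hy : y ≠ 0) : Reduces x⁻¹ y⁻¹ := by
  obtain ⟨z, rfl, rfl⟩ := h
  have hz : IsUnit z := by
    rw [PadicInt.isUnit_iff]
    by_contra hne
    have hlt : ‖z‖ < 1 := lt_of_le_of_ne z.norm_le_one hne
    rw [PadicInt.norm_lt_one_iff_dvd] at hlt
    obtain ⟨w, rfl⟩ := hlt
    simp at hy
  obtain ⟨w, hw⟩ := hz.exists_right_inv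
  refine ⟨w, ?_, ?_⟩
  · have : (z : ℚ_[p]) * w = 1 := by rw [← PadicInt.coe_mul, hw]; simp
    exact eq_inv_of_mul_eq_one_right this
  · refine eq_inv_of_mul_eq_one_right ?_
    rw [← map_mul, hw, map_one]

theorem div (h : Reduces x y) (h' : Reduces x' y') (hy : y' ≠ 0) :
    Reduces (x / x') (y / y') := by
  rw [div_eq_mul_inv, div_eq_mul_inv]; exact h.mul (h'.inv hy)

theorem sum {ι : Type*} (s : Finset ι) (f : ι → ℚ_[p]) (g : ι → ZMod p)
    (h : ∀ i ∈ s, Reduces (f i) (g i)) : Reduces (∑ i ∈ s, f i) (∑ i ∈ s, g i) := by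
  classical
  induction s using Finset.induction_on with
  | empty => simpa using zero
  | insert i s hi ih =>
    rw [Finset.sum_insert hi, Finset.sum_insert hi]
    exact (h i (by simp)).add (ih fun j hj => h j (by simp [hj]))

theorem prod {ι : Type*} (s : Finset ι) (f : ι → ℚ_[p]) (g : ι → ZMod p)
    (h : ∀ i ∈ s, Reduces (f i) (g i)) : Reduces (∏ i ∈ s, f i) (∏ i ∈ s, g i) := by
  classical
  induction s using Finset.induction_on with
  | empty => simpa using one
  | insert i s hi ih =>
    rw [Finset.prod_insert hi, Finset.prod_insert hi]
    exact (h i (by simp)).mul (ih fun j hj => h j (by simp [hj]))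

theorem unique (h : Reduces x y) (h' : Reduces x y') : y = y' := by
  obtain ⟨z, rfl, rfl⟩ := h
  obtain ⟨w, hw, rfl⟩ := h'
  rw [Subtype.coe_injective hw]

theorem padicCongr (h : Reduces x y) (h' : Reduces x' y) : PadicCongr p 1 x x' := by
  obtain ⟨z, rfl, rfl⟩ := h
  obtain ⟨w, rfl, hw⟩ := h'
  have : z - w ∈ IsLocalRing.maximalIdeal ℤ_[p] := by
    rw [← PadicInt.ker_toZMod, RingHom.mem_ker, map_sub, hw, sub_self]
  rw [PadicInt.maximalIdeal_eq_span_p, Ideal.mem_span_singleton] at this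
  obtain ⟨u, hu⟩ := this
  exact ⟨u, by rw [← PadicInt.coe_sub, hu]; simp⟩

theorem of_padicCongr (h : Reduces x y) (h' : PadicCongr p 1 x' x) : Reduces x' y := by
  obtain ⟨z, rfl, rfl⟩ := h
  obtain ⟨w, hw⟩ := h'
  exact ⟨z + p * w, by rw [sub_eq_iff_eq_add] at hw; rw [hw]; push_cast; ring, by simp⟩

theorem integral (h : Reduces x y) : PadicCongr p 0 x 0 := by
  obtain ⟨z, rfl, rfl⟩ := h
  exact ⟨z, by simp⟩

theorem prime : Reduces (p : ℚ_[p]) 0 := by simpa using natCast (p := p) p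

end Reduces

namespace PadicCongr

variable {m : ℕ} {x x' y y' z : ℚ_[p]}

theorem refl (m : ℕ) (x : ℚ_[p]) : PadicCongr p m x x := ⟨0, by simp⟩

theorem symm (h : PadicCongr p m x y) : PadicCongr p m y x := by
  obtain ⟨u, hu⟩ := h
  exact ⟨-u, by push_cast; rw [mul_neg, ← hu]; ring⟩

theorem add (h : PadicCongr p m x y) (h' : PadicCongr p m x' y') :
    PadicCongr p m (x + x') (y + y') := by
  obtain ⟨u, hu⟩ := h
  obtain ⟨v, hv⟩ := h'
  exact ⟨u + v, by push_cast; rw [mul_add, ← hu, ← hv]; ring⟩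

theorem trans (h : PadicCongr p m x y) (h' : PadicCongr p m y z) : PadicCongr p m x z := by
  obtain ⟨u, hu⟩ := h
  obtain ⟨v, hv⟩ := h'
  exact ⟨u + v, by push_cast; rw [mul_add, ← hu, ← hv]; ring⟩

theorem mul_left (hz : PadicCongr p 0 z 0) (h : PadicCongr p m x y) :
    PadicCongr p m (z * x) (z * y) := by
  obtain ⟨u, hu⟩ := h
  obtain ⟨v, hv⟩ := hz
  refine ⟨v * u, ?_⟩
  rw [sub_zero, pow_zero, one_mul] at hv
  push_cast
  rw [← mul_sub, hu, hv]; ring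

theorem integral_of (h : PadicCongr p m x y) (hy : PadicCongr p 0 y 0) : PadicCongr p 0 x 0 := by
  obtain ⟨u, hu⟩ := h
  obtain ⟨v, hv⟩ := hy
  refine ⟨v + p ^ m * u, ?_⟩
  push_cast
  rw [← hu]
  linear_combination hv

/-- From xx' - yy' = x(x' - y') + (x - y)y'. Integrality of x and y' must be assumed because the
congruence lives on ℚ_p, and modulus p^0 expresses it. -/
theorem mul (h : PadicCongr p m x y) (h' : PadicCongr p m x' y') (hx : PadicCongr p 0 x 0)
    (hy : PadicCongr p 0 y' 0) : PadicCongr p m (x * x') (y * y') := by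
  refine (mul_left hx h').trans ?_
  rw [mul_comm x, mul_comm y]
  exact mul_left hy h

theorem sum {ι : Type*} (s : Finset ι) (f g : ι → ℚ_[p])
    (h : ∀ i ∈ s, PadicCongr p m (f i) (g i)) :
    PadicCongr p m (∑ i ∈ s, f i) (∑ i ∈ s, g i) := by
  classical
  induction s using Finset.induction_on with
  | empty => simpa using refl m 0
  | insert i s hi ih =>
    rw [Finset.sum_insert hi, Finset.sum_insert hi]
    exact (h i (by simp)).add (ih fun j hj => h j (by simp [hj]))

theorem prod {ι : Type*} (s : Finset ι) (f g : ι → ℚ_[p])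
    (h : ∀ i ∈ s, PadicCongr p m (f i) (g i)) (hg : ∀ i ∈ s, PadicCongr p 0 (g i) 0) :
    PadicCongr p m (∏ i ∈ s, f i) (∏ i ∈ s, g i) := by
  classical
  induction s using Finset.induction_on with
  | empty => simpa using refl m 1
  | insert i s hi ih =>
    rw [Finset.prod_insert hi, Finset.prod_insert hi]
    have hprod : PadicCongr p 0 (∏ j ∈ s, g j) 0 := by
      have : ∀ t : Finset ι, t ⊆ s → PadicCongr p 0 (∏ j ∈ t, g j) 0 := by
        intro t
        induction t using Finset.induction_on with
        | empty => intro _; exact ⟨1, by simp⟩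
        | insert k t hk iht =>
          intro ht
          rw [Finset.prod_insert hk]
          have := mul_left (hg k (by simp [ht (Finset.mem_insert_self k t)]))
            (iht ((Finset.subset_insert k t).trans ht))
          simpa using this
      exact this s subset_rfl
    exact mul (h i (by simp)) (ih (fun j hj => h j (by simp [hj])) fun j hj => hg j (by simp [hj]))
      ((h i (by simp)).integral_of (hg i (by simp))) hprod

theorem prime_pow_mul (k : ℕ) (h : PadicCongr p m x y) :
    PadicCongr p (m + k) ((p : ℚ_[p]) ^ k * x) ((p : ℚ_[p]) ^ k * y) := by
  obtain ⟨u, hu⟩ := h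
  exact ⟨u, by rw [← mul_sub, hu]; ring⟩

theorem prime_mul (h : PadicCongr p 1 x y) :
    PadicCongr p 2 ((p : ℚ_[p]) * x) ((p : ℚ_[p]) * y) := by
  simpa using prime_pow_mul 1 h

theorem mono {k : ℕ} (hk : k ≤ m) (h : PadicCongr p m x y) : PadicCongr p k x y := by
  obtain ⟨u, hu⟩ := h
  obtain ⟨l, rfl⟩ := Nat.exists_eq_add_of_le hk
  exact ⟨p ^ l * u, by rw [hu]; push_cast; ring⟩

end PadicCongr

end Calculus

/-! ### The Dixon and Whipple summations, by telescoping in k -/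

section Identities

variable {K : Type*} [Field K]

/-- The rising factorial `x (x + 1) ⋯ (x + k - 1)`. -/
def poch (x : K) (k : ℕ) : K := ∏ j ∈ Finset.range k, (x + j)

theorem poch_succ (x : K) (k : ℕ) : poch x (k + 1) = poch x k * (x + k) :=
  Finset.prod_range_succ _ _

theorem poch_zero (x : K) : poch x 0 = 1 := rfl

theorem poch_succ' (x : K) (k : ℕ) : poch x (k + 1) = x * poch (x + 1) k := by
  unfold poch
  rw [Finset.prod_range_succ', mul_comm, Nat.cast_zero, add_zero]
  congr 1
  exact Finset.prod_congr rfl fun j _ => by push_cast; ring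

theorem poch_ne_zero {x : K} {k : ℕ} (h : ∀ j < k, x + j ≠ 0) : poch x k ≠ 0 :=
  Finset.prod_ne_zero_iff.2 fun j hj => h j (Finset.mem_range.1 hj)

theorem poch_neg_natCast (n : ℕ) : poch (-(n : K)) (n + 1) = 0 := by
  rw [poch_succ]; simp

/-- The summand of the terminating well-poised `₃F₂(a, b, -n; 1 + a - b, 1 + a + n; 1)`. -/
def dixonTerm (a b : K) (n k : ℕ) : K :=
  poch a k * poch b k * poch (-(n : K)) k /
    (poch 1 k * poch (1 + a - b) k * poch (1 + a + n) k)

variable [CharZero K]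

theorem poch_one_ne_zero (k : ℕ) : poch (1 : K) k ≠ 0 :=
  poch_ne_zero fun j _ => by rw [add_comm]; exact Nat.cast_add_one_ne_zero j

/-- A Zeilberger-type certificate for the first-order recurrence in n: the partial sums have a
closed form whose factor (-n)_k vanishes at k = n+1, which leaves the recurrence for the full sums.
-/
theorem sum_dixonTerm_telescope (a b : K) (n k : ℕ) (h1 : ∀ j < k, 1 + a - b + j ≠ 0)
    (h2 : ∀ j < n + k + 1, 1 + a + j ≠ 0) :
    ∑ i ∈ Finset.range (k + 1), ((1 + a / 2 + n) * (1 + a - b + n) * dixonTerm a b (n + 1) i -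
        (1 + a + n) * (1 + a / 2 - b + n) * dixonTerm a b n i) =
      poch a (k + 1) * poch b (k + 1) * poch (-(n : K)) k /
        (2 * (poch 1 k * poch (1 + a - b) k * poch (2 + a + n) k)) := by
  induction k with
  | zero =>
    simp only [zero_add, Finset.sum_range_one, dixonTerm, poch_zero, poch_succ]
    field_simp
    push_cast
    ring
  | succ k ih =>
    rw [Finset.sum_range_succ, ih (fun j hj => h1 j (by omega)) (fun j hj => h2 j (by omega))]
    unfold dixonTerm
    -- The parameters shifted by n ↦ n+1 are brought back to common Pochhammer symbols, so that
    -- after generalising these only a rational identity is left.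
    have e1 : poch (-((n + 1 : ℕ) : K)) (k + 1) = -(n + 1) * poch (-(n : K)) k := by
      rw [poch_succ']; push_cast; ring_nf
    have e2 : poch (1 + a + n) (k + 1) = (1 + a + n) * poch (2 + a + n) k := by
      rw [poch_succ']; ring_nf
    have e3 : (1 + a + ((n + 1 : ℕ) : K)) = 2 + a + n := by push_cast; ring
    rw [e1, e2, e3, poch_succ a (k + 1), poch_succ b (k + 1), poch_succ (-(n : K)) k,
      poch_succ 1 k, poch_succ (1 + a - b) k, poch_succ (2 + a + n) k]
    have n1 : poch (1 : K) k ≠ 0 := poch_one_ne_zero k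
    have n2 : poch (1 + a - b) k ≠ 0 := poch_ne_zero fun j hj => h1 j (by omega)
    have n3 : poch (2 + a + n) k ≠ 0 := poch_ne_zero fun j hj => by
      have := h2 (n + 1 + j) (by omega)
      push_cast at this
      convert this using 1; ring
    have n4 : (1 : K) + k ≠ 0 := by rw [add_comm]; exact Nat.cast_add_one_ne_zero k
    have n5 : 1 + a - b + k ≠ 0 := h1 k (by omega)
    have n6 : 2 + a + n + k ≠ 0 := by
      have := h2 (n + 1 + k) (by omega)
      push_cast at this
      convert this using 1; ring
    have n7 : 1 + a + n ≠ 0 := h2 n (by omega)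
    generalize poch (1 : K) k = P1 at *
    generalize poch (1 + a - b) k = P2 at *
    generalize poch (2 + a + n) k = P3 at *
    generalize poch (-(n : K)) k = P4 at *
    generalize poch a (k + 1) = P5 at *
    generalize poch b (k + 1) = P6 at *
    push_cast
    field_simp
    ring

theorem sum_dixonTerm (a b : K) (n : ℕ) (h1 : ∀ j < n, 1 + a - b + j ≠ 0)
    (h2 : ∀ j < 2 * n, 1 + a + j ≠ 0) (h3 : ∀ j < n, 1 + a / 2 + j ≠ 0) :
    ∑ k ∈ Finset.range (n + 1), dixonTerm a b n k =
      ∏ j ∈ Finset.range n,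
        (1 + a + j) * (1 + a / 2 - b + j) / ((1 + a / 2 + j) * (1 + a - b + j)) := by
  induction n with
  | zero => simp [dixonTerm, poch_zero]
  | succ n ih =>
    have ih := ih (fun j hj => h1 j (by omega)) (fun j hj => h2 j (by omega))
      (fun j hj => h3 j (by omega))
    have key := sum_dixonTerm_telescope a b n (n + 1) (fun j hj => h1 j (by omega))
      (fun j hj => h2 j (by omega))
    rw [poch_neg_natCast, mul_zero, zero_div, Finset.sum_sub_distrib, ← Finset.mul_sum,
      ← Finset.mul_sum, Finset.sum_range_succ (fun i => dixonTerm a b n i) (n + 1), ih] at key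
    have : dixonTerm a b n (n + 1) = 0 := by
      unfold dixonTerm; rw [poch_neg_natCast]; simp
    rw [this, add_zero] at key
    rw [Finset.prod_range_succ]
    have n1 := h1 n (by omega)
    have n3 := h3 n (by omega)
    have : (1 + a / 2 + n) * (1 + a - b + n) ≠ 0 := mul_ne_zero n3 n1
    rw [← mul_div_assoc, eq_div_iff this]
    linear_combination key

/-- The summand of `₃F₂(-n, n + 1, 1/2; 1 + √e, 1 - √e; 1)`. -/
def whippleTerm (e : K) (n k : ℕ) : K :=
  poch (-(n : K)) k * poch (n + 1 : K) k * poch (1 / 2) k /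
    (poch 1 k * ∏ j ∈ Finset.range k, ((j + 1 : K) ^ 2 - e))

/-- The same method, with a recurrence of step 2 in n. Only (1+√e)_k (1-√e)_k = ∏ ((j+1)^2 - e)
occurs, so no square root of e is needed. -/
theorem sum_whippleTerm_telescope (e : K) (n k : ℕ) (h : ∀ j < k, (j + 1 : K) ^ 2 - e ≠ 0) :
    ∑ i ∈ Finset.range (k + 1), (((n + 2 : K) ^ 2 - e) * whippleTerm e (n + 2) i -
        ((n + 1 : K) ^ 2 - e) * whippleTerm e n i) =
      (2 * n + 3) * (poch (-((n + 1 : ℕ) : K)) k * poch (n + 2 : K) k * poch (3 / 2) k) /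
        (poch 1 k * ∏ j ∈ Finset.range k, ((j + 1 : K) ^ 2 - e)) := by
  induction k with
  | zero =>
    simp [whippleTerm, poch_zero]
    ring
  | succ k ih =>
    rw [Finset.sum_range_succ, ih (fun j hj => h j (by omega))]
    unfold whippleTerm
    have e1 : poch (-((n + 2 : ℕ) : K)) (k + 1) =
        -(n + 2) * poch (-((n + 1 : ℕ) : K)) k := by
      rw [poch_succ']; push_cast; ring_nf
    -- Stated with the factor n+1 to avoid a division; that factor is supplied by `e3` when the two
    -- are multiplied in `e7`.
    have e2 : (n + 1) * poch (-(n : K)) (k + 1) =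
        -(poch (-((n + 1 : ℕ) : K)) k * (k - n - 1) * (k - n)) := by
      have := poch_succ' (-((n + 1 : ℕ) : K)) (k + 1)
      rw [poch_succ, poch_succ] at this
      push_cast at this ⊢
      have e : (-((n : K) + 1) + 1) = -n := by ring
      rw [e] at this
      linear_combination this
    have e3 : poch (n + 1 : K) (k + 1) = (n + 1) * poch (n + 2 : K) k := by
      rw [poch_succ']; ring_nf
    have e4 : (n + 2) * poch (((n + 2 : ℕ) : K) + 1) (k + 1) =
        poch (n + 2 : K) k * (n + 2 + k) * (n + 3 + k) := by
      have := poch_succ' (n + 2 : K) (k + 1)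
      rw [poch_succ, poch_succ] at this
      push_cast at this ⊢
      linear_combination -this
    have e5 : poch (1 / 2 : K) (k + 1) = 1 / 2 * poch (3 / 2) k := by
      rw [poch_succ']; norm_num
    have e6 : poch (-((n + 2 : ℕ) : K)) (k + 1) * poch (((n + 2 : ℕ) : K) + 1) (k + 1) =
        -(poch (-((n + 1 : ℕ) : K)) k * (poch (n + 2 : K) k * (n + 2 + k) * (n + 3 + k))) := by
      rw [e1, ← e4]; ring
    have e7 : poch (-(n : K)) (k + 1) * poch (n + 1 : K) (k + 1) =
        -(poch (-((n + 1 : ℕ) : K)) k * (k - n - 1) * (k - n) * poch (n + 2 : K) k) := by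
      rw [e3, ← mul_assoc, mul_comm _ (n + 1 : K), e2]; ring
    rw [e6, e7, e5, poch_succ (-((n + 1 : ℕ) : K)) k, poch_succ (n + 2 : K) k,
      poch_succ (3 / 2 : K) k, poch_succ 1 k, Finset.prod_range_succ]
    have n1 : poch (1 : K) k ≠ 0 := poch_one_ne_zero k
    have n2 : ∏ j ∈ Finset.range k, ((j + 1 : K) ^ 2 - e) ≠ 0 :=
      Finset.prod_ne_zero_iff.2 fun j hj => h j (by have := Finset.mem_range.1 hj; omega)
    have n4 : (1 : K) + k ≠ 0 := by rw [add_comm]; exact Nat.cast_add_one_ne_zero k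
    have n5 : (k + 1 : K) ^ 2 - e ≠ 0 := h k (by omega)
    generalize poch (1 : K) k = P1 at *
    generalize ∏ j ∈ Finset.range k, ((j + 1 : K) ^ 2 - e) = P2 at *
    generalize poch (-((n + 1 : ℕ) : K)) k = P3 at *
    generalize poch (n + 2 : K) k = P4 at *
    generalize poch (3 / 2 : K) k = P5 at *
    push_cast
    field_simp
    ring

theorem sum_whippleTerm_rec (e : K) (n : ℕ) (h : ∀ j < n + 2, (j + 1 : K) ^ 2 - e ≠ 0) :
    ((n + 2 : K) ^ 2 - e) * ∑ k ∈ Finset.range (n + 3), whippleTerm e (n + 2) k =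
      ((n + 1 : K) ^ 2 - e) * ∑ k ∈ Finset.range (n + 1), whippleTerm e n k := by
  have key := sum_whippleTerm_telescope e n (n + 2) h
  have z1 : whippleTerm e n (n + 1) = 0 := by
    unfold whippleTerm; rw [poch_neg_natCast]; simp
  have z2 : whippleTerm e n (n + 2) = 0 := by
    unfold whippleTerm; rw [poch_succ, poch_neg_natCast]; simp
  rw [poch_neg_natCast, zero_mul, zero_mul, mul_zero, zero_div, Finset.sum_sub_distrib,
    ← Finset.mul_sum, ← Finset.mul_sum, sub_eq_zero] at key
  rw [key, Finset.sum_range_succ, Finset.sum_range_succ _ (n + 1), z1, z2, add_zero, add_zero]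

theorem sum_whippleTerm_even (e : K) (m : ℕ) (h : ∀ j < 2 * m, (j + 1 : K) ^ 2 - e ≠ 0) :
    ∑ k ∈ Finset.range (2 * m + 1), whippleTerm e (2 * m) k =
      ∏ j ∈ Finset.range m, ((2 * j + 1 : K) ^ 2 - e) / ((2 * j + 2 : K) ^ 2 - e) := by
  induction m with
  | zero => simp [whippleTerm, poch_zero]
  | succ m ih =>
    have key := sum_whippleTerm_rec e (2 * m) (fun j hj => h j (by omega))
    rw [ih (fun j hj => h j (by omega))] at key
    have hn := h (2 * m + 1) (by omega)
    push_cast at hn key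
    have hn' : (2 * m + 2 : K) ^ 2 - e ≠ 0 := by convert hn using 2; ring
    rw [Finset.prod_range_succ, ← mul_div_assoc, eq_div_iff hn', mul_comm, mul_comm (∏ _ ∈ _, _)]
    exact key

/-- The step-2 recurrence splits by parity. The odd chain starts at n = 1, whose sum -e/(1-e)
vanishes at e = 0. -/
theorem sum_whippleTerm_odd (e : K) (m : ℕ) (h : ∀ j < 2 * m + 1, (j + 1 : K) ^ 2 - e ≠ 0) :
    ∑ k ∈ Finset.range (2 * m + 2), whippleTerm e (2 * m + 1) k =
      -e / (1 - e) *
        ∏ j ∈ Finset.range m, ((2 * j + 2 : K) ^ 2 - e) / ((2 * j + 3 : K) ^ 2 - e) := by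
  induction m with
  | zero =>
    have := h 0 (by omega)
    simp [whippleTerm, poch_zero, poch_succ, Finset.sum_range_succ] at this ⊢
    field_simp
    ring
  | succ m ih =>
    have key := sum_whippleTerm_rec e (2 * m + 1) (fun j hj => h j (by omega))
    rw [ih (fun j hj => h j (by omega))] at key
    have hn := h (2 * m + 2) (by omega)
    push_cast at hn key
    have hn' : (2 * m + 3 : K) ^ 2 - e ≠ 0 := by convert hn using 2; ring
    rw [Finset.prod_range_succ, ← mul_assoc, ← mul_div_assoc, eq_div_iff hn']
    have e1 : (2 * m + 1 + 2 : K) = 2 * m + 3 := by ring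
    have e2 : (2 * m + 1 + 1 : K) = 2 * m + 2 := by ring
    rw [e1, e2] at key
    linear_combination key

end Identities

/-! ### Logarithmic derivatives of products -/

section LogDerivative

variable {𝕜 : Type*} [NontriviallyNormedField 𝕜]

/-- `f` has logarithmic derivative `l` at `x`, where `f x = 0` is allowed. -/
def HasLogDerivAt (f : 𝕜 → 𝕜) (l x : 𝕜) : Prop := HasDerivAt f (f x * l) x

namespace HasLogDerivAt

variable {f g : 𝕜 → 𝕜} {l m x : 𝕜}

theorem mul (hf : HasLogDerivAt f l x) (hg : HasLogDerivAt g m x) :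
    HasLogDerivAt (fun y => f y * g y) (l + m) x := by
  unfold HasLogDerivAt at *
  exact (HasDerivAt.fun_mul hf hg).congr_deriv (by ring)

theorem div (hf : HasLogDerivAt f l x) (hg : HasLogDerivAt g m x) (hx : g x ≠ 0) :
    HasLogDerivAt (fun y => f y / g y) (l - m) x := by
  unfold HasLogDerivAt at *
  exact (HasDerivAt.fun_div hf hg hx).congr_deriv (by field_simp)

theorem const (c : 𝕜) : HasLogDerivAt (fun _ => c) 0 x := by
  unfold HasLogDerivAt
  simpa using hasDerivAt_const x c

theorem prod {ι : Type*} (s : Finset ι) (f : ι → 𝕜 → 𝕜) (l : ι → 𝕜)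
    (h : ∀ i ∈ s, HasLogDerivAt (f i) (l i) x) :
    HasLogDerivAt (fun y => ∏ i ∈ s, f i y) (∑ i ∈ s, l i) x := by
  classical
  induction s using Finset.induction_on with
  | empty => simpa using const (1 : 𝕜)
  | insert i s hi ih =>
    simp only [Finset.prod_insert hi, Finset.sum_insert hi]
    exact (h i (by simp)).mul (ih fun j hj => h j (by simp [hj]))

theorem affine (c r : 𝕜) (hc : c ≠ 0) : HasLogDerivAt (fun y => c + r * y) (r / c) 0 := by
  unfold HasLogDerivAt
  exact (((hasDerivAt_id' (0 : 𝕜)).const_mul r).const_add c).congr_deriv (by field_simp; ring)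

theorem poch (c r : 𝕜) (k : ℕ) (h : ∀ j < k, c + j ≠ 0) :
    HasLogDerivAt (fun y => poch (c + r * y) k) (∑ j ∈ Finset.range k, r / (c + j)) 0 := by
  unfold _root_.poch
  refine prod _ _ _ fun j hj => ?_
  have := affine (c + j) r (h j (Finset.mem_range.1 hj))
  convert this using 2
  ring

end HasLogDerivAt

theorem eventually_forall_affine_ne_zero (N : ℕ) (c : ℕ → 𝕜) (r : 𝕜) (h : ∀ j < N, c j ≠ 0) :
    ∀ᶠ x in 𝓝 (0 : 𝕜), ∀ j < N, c j + r * x ≠ 0 := by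
  have : ∀ᶠ x in 𝓝 (0 : 𝕜), ∀ j ∈ Set.Iio N, c j + r * x ≠ 0 := by
    rw [Filter.eventually_all_finite (Set.finite_Iio N)]
    intro j hj
    have hc : ContinuousAt (fun x : 𝕜 => c j + r * x) 0 := by fun_prop
    exact hc.eventually_ne (by simpa using h j hj)
  exact this

end LogDerivative

/-! ### The differentiated summations -/

section Derivatives

variable {𝕜 : Type*} [NontriviallyNormedField 𝕜] [CharZero 𝕜]

theorem half_add_ne_zero (j : ℕ) : (1 / 2 + j : 𝕜) ≠ 0 := by
  have : ((2 * j + 1 : ℕ) : 𝕜) ≠ 0 := by norm_cast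
  intro h
  apply this
  push_cast
  linear_combination 2 * h

/-- Derivative at x = 0 of Dixon's identity at a = 1/2 + x, b = 1/2 + q/2 + 2x. With slopes 1 and 2
the lower parameters 1+a-b and 1+a+n move with slopes -1 and 1, so their contributions cancel to
leading order in q and no first-order harmonic numbers survive. -/
theorem sum_dixonTerm_mul_logDeriv (n : ℕ) (q : 𝕜) (hq : q = 2 * n + 1) :
    ∑ k ∈ Finset.range (n + 1), dixonTerm (1 / 2) (1 / 2 + q / 2) n k *
      (∑ j ∈ Finset.range k, 1 / (1 / 2 + j : 𝕜) + ∑ j ∈ Finset.range k, 2 / (1 / 2 + q / 2 + j)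
        - (∑ j ∈ Finset.range k, -1 / (1 - q / 2 + j) +
          ∑ j ∈ Finset.range k, 1 / (3 / 2 + n + j : 𝕜))) =
    (∑ k ∈ Finset.range (n + 1), dixonTerm (1 / 2) (1 / 2 + q / 2) n k) *
      ∑ j ∈ Finset.range n, (1 / (3 / 2 + j : 𝕜) + -(3 / 2) / (3 / 4 - q / 2 + j) -
        (1 / 2 / (5 / 4 + j) + -1 / (1 - q / 2 + j))) := by
  -- After clearing denominators with q = 2n+1, each factor is a positive integer or, in `c2` and
  -- `c5`, an odd one.
  have c1 : ∀ j : ℕ, (1 / 2 + q / 2 + j : 𝕜) ≠ 0 := by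
    intro j h
    have : ((n + j + 1 : ℕ) : 𝕜) ≠ 0 := by exact_mod_cast (by omega : n + j + 1 ≠ 0)
    apply this; push_cast; linear_combination h - hq / 2
  have c2 : ∀ j : ℕ, (1 - q / 2 + j : 𝕜) ≠ 0 := by
    intro j h
    have : ((2 * j + 1 - 2 * n : ℤ) : 𝕜) ≠ 0 := by exact_mod_cast (by omega : (2 * j + 1 - 2 * n : ℤ) ≠ 0)
    apply this; push_cast; linear_combination 2 * h + hq
  have c3 : ∀ j : ℕ, (3 / 2 + n + j : 𝕜) ≠ 0 := by
    intro j h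
    have : ((2 * n + 2 * j + 3 : ℕ) : 𝕜) ≠ 0 := by norm_cast
    apply this; push_cast; linear_combination 2 * h
  have c4 : ∀ j : ℕ, (3 / 2 + j : 𝕜) ≠ 0 := by
    intro j h
    have : ((2 * j + 3 : ℕ) : 𝕜) ≠ 0 := by norm_cast
    apply this; push_cast; linear_combination 2 * h
  have c5 : ∀ j : ℕ, (3 / 4 - q / 2 + j : 𝕜) ≠ 0 := by
    intro j h
    have : ((4 * j + 1 - 4 * n : ℤ) : 𝕜) ≠ 0 := by exact_mod_cast (by omega : (4 * j + 1 - 4 * n : ℤ) ≠ 0)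
    apply this; push_cast; linear_combination 4 * h + 2 * hq
  have c6 : ∀ j : ℕ, (5 / 4 + j : 𝕜) ≠ 0 := by
    intro j h
    have : ((4 * j + 5 : ℕ) : 𝕜) ≠ 0 := by norm_cast
    apply this; push_cast; linear_combination 4 * h
  have hterm : ∀ k, HasLogDerivAt
      (fun x : 𝕜 => poch (1 / 2 + 1 * x) k * poch (1 / 2 + q / 2 + 2 * x) k * poch (-(n : 𝕜)) k /
        (poch 1 k * poch (1 - q / 2 + -1 * x) k * poch (3 / 2 + n + 1 * x) k))
      ((∑ j ∈ Finset.range k, 1 / (1 / 2 + j : 𝕜) + ∑ j ∈ Finset.range k, 2 / (1 / 2 + q / 2 + j)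
        + 0) - (0 + ∑ j ∈ Finset.range k, -1 / (1 - q / 2 + j) +
          ∑ j ∈ Finset.range k, 1 / (3 / 2 + n + j : 𝕜))) 0 := by
    intro k
    refine HasLogDerivAt.div (((HasLogDerivAt.poch _ _ k fun j _ => half_add_ne_zero j).mul
      (HasLogDerivAt.poch _ _ k fun j _ => c1 j)).mul (HasLogDerivAt.const _))
      (((HasLogDerivAt.const _).mul (HasLogDerivAt.poch _ _ k fun j _ => c2 j)).mul
      (HasLogDerivAt.poch _ _ k fun j _ => c3 j)) ?_
    simp only [mul_zero, add_zero]
    exact mul_ne_zero (mul_ne_zero (poch_one_ne_zero k) (poch_ne_zero fun j _ => c2 j))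
      (poch_ne_zero fun j _ => c3 j)
  have hprod : HasLogDerivAt (fun x : 𝕜 => ∏ j ∈ Finset.range n,
        ((3 / 2 + j : 𝕜) + 1 * x) * ((3 / 4 - q / 2 + j) + -(3 / 2) * x) /
          (((5 / 4 + j : 𝕜) + 1 / 2 * x) * ((1 - q / 2 + j) + -1 * x)))
      (∑ j ∈ Finset.range n, (1 / (3 / 2 + j : 𝕜) + -(3 / 2) / (3 / 4 - q / 2 + j) -
        (1 / 2 / (5 / 4 + j) + -1 / (1 - q / 2 + j)))) 0 := by
    refine HasLogDerivAt.prod _ _ _ fun j _ => ?_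
    refine HasLogDerivAt.div ((HasLogDerivAt.affine _ _ (c4 j)).mul
      (HasLogDerivAt.affine _ _ (c5 j))) ((HasLogDerivAt.affine _ _ (c6 j)).mul
      (HasLogDerivAt.affine _ _ (c2 j))) ?_
    simpa using ⟨c6 j, c2 j⟩
  -- Dixon's identity requires nonzero denominators, which holds for x near 0; equality of germs is
  -- enough to compare derivatives.
  have heq : (fun x : 𝕜 => ∏ j ∈ Finset.range n,
        ((3 / 2 + j : 𝕜) + 1 * x) * ((3 / 4 - q / 2 + j) + -(3 / 2) * x) /
          (((5 / 4 + j : 𝕜) + 1 / 2 * x) * ((1 - q / 2 + j) + -1 * x))) =ᶠ[𝓝 0]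
      fun x : 𝕜 => ∑ k ∈ Finset.range (n + 1),
        poch (1 / 2 + 1 * x) k * poch (1 / 2 + q / 2 + 2 * x) k * poch (-(n : 𝕜)) k /
        (poch 1 k * poch (1 - q / 2 + -1 * x) k * poch (3 / 2 + n + 1 * x) k) := by
    filter_upwards [eventually_forall_affine_ne_zero n (fun j => 1 - q / 2 + j) (-1) fun j _ => c2 j,
      eventually_forall_affine_ne_zero (2 * n) (fun j => (3 / 2 + j : 𝕜)) 1 fun j _ => c4 j,
      eventually_forall_affine_ne_zero n (fun j => (5 / 4 + j : 𝕜)) (1 / 2) fun j _ => c6 j]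
      with x h1 h2 h3
    have e1 : (1 : 𝕜) + (1 / 2 + 1 * x) - (1 / 2 + q / 2 + 2 * x) = 1 - q / 2 + -1 * x := by ring
    have e2 : (1 : 𝕜) + (1 / 2 + 1 * x) = 3 / 2 + 1 * x := by ring
    have e3 : (1 : 𝕜) + (1 / 2 + 1 * x) / 2 = 5 / 4 + 1 / 2 * x := by ring
    have key := sum_dixonTerm (1 / 2 + 1 * x) (1 / 2 + q / 2 + 2 * x) n ?_ ?_ ?_
    · simp only [dixonTerm, e1] at key
      simp only [e2, e3] at key
      have e4 : 3 / 2 + 1 * x + (n : 𝕜) = 3 / 2 + n + 1 * x := by ring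
      rw [e4] at key
      rw [key]
      exact Finset.prod_congr rfl fun j _ => by ring
    · intro j hj; rw [e1]; convert h1 j hj using 1; ring
    · intro j hj; rw [e2]; convert h2 j hj using 1; ring
    · intro j hj; rw [e3]; convert h3 j hj using 1; ring
  have hval := heq.eq_of_nhds
  have hsum := HasDerivAt.fun_sum (u := Finset.range (n + 1)) (fun k _ => hterm k)
  have := (hprod.congr_of_eventuallyEq heq.symm).unique hsum
  dsimp only at hval this
  rw [hval] at this
  simp only [mul_zero, add_zero, zero_add] at this
  have ht : ∀ k, dixonTerm (1 / 2) (1 / 2 + q / 2) n k =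
      poch (1 / 2) k * poch (1 / 2 + q / 2) k * poch (-(n : 𝕜)) k /
        (poch 1 k * poch (1 - q / 2) k * poch (3 / 2 + n : 𝕜) k) := by
    intro k
    unfold dixonTerm
    congr 3
    · congr 1; ring
    · ring
  simp only [ht]
  exact this.symm

/-- The summand `(-n)ₖ (n+1)ₖ (1/2)ₖ / k!³`. -/
def legendreTerm (n k : ℕ) : 𝕜 :=
  poch (-(n : 𝕜)) k * poch (n + 1 : 𝕜) k * poch (1 / 2) k /
    (poch 1 k * ∏ j ∈ Finset.range k, (j + 1 : 𝕜) ^ 2)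

theorem add_one_sq_ne_zero (j : ℕ) : (j + 1 : 𝕜) ^ 2 ≠ 0 :=
  pow_ne_zero _ (Nat.cast_add_one_ne_zero j)

theorem hasDerivAt_sum_whippleTerm (n : ℕ) :
    HasDerivAt (fun e : 𝕜 => ∑ k ∈ Finset.range (n + 1), whippleTerm e n k)
      (∑ k ∈ Finset.range (n + 1),
        legendreTerm n k * ∑ j ∈ Finset.range k, 1 / (j + 1 : 𝕜) ^ 2) 0 := by
  refine HasDerivAt.fun_sum fun k _ => ?_
  have hprod : HasLogDerivAt (fun e : 𝕜 => ∏ j ∈ Finset.range k, ((j + 1 : 𝕜) ^ 2 + -1 * e))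
      (∑ j ∈ Finset.range k, -1 / (j + 1 : 𝕜) ^ 2) 0 :=
    HasLogDerivAt.prod _ _ _ fun j _ => HasLogDerivAt.affine _ _ (add_one_sq_ne_zero j)
  have h := HasLogDerivAt.div (x := (0 : 𝕜)) (HasLogDerivAt.const
    (poch (-(n : 𝕜)) k * poch (n + 1 : 𝕜) k * poch (1 / 2) k))
    ((HasLogDerivAt.const (poch 1 k)).mul hprod) (by
      simp only [mul_zero, add_zero]
      exact mul_ne_zero (poch_one_ne_zero k)
        (Finset.prod_ne_zero_iff.2 fun j _ => add_one_sq_ne_zero j))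
  unfold HasLogDerivAt at h
  simp only [mul_zero, add_zero, zero_sub, neg_mul, one_mul, ← sub_eq_add_neg,
    neg_div, Finset.sum_neg_distrib, neg_neg] at h
  exact h

theorem eventually_add_one_sq_sub_ne_zero (N : ℕ) :
    ∀ᶠ e in 𝓝 (0 : 𝕜), ∀ j < N, (j + 1 : 𝕜) ^ 2 - e ≠ 0 := by
  filter_upwards [eventually_forall_affine_ne_zero N (fun j => (j + 1 : 𝕜) ^ 2) (-1)
    fun j _ => add_one_sq_ne_zero j] with e he j hj
  convert he j hj using 1; ring

omit [CharZero 𝕜] in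
theorem whippleTerm_zero (n k : ℕ) : whippleTerm (0 : 𝕜) n k = legendreTerm n k := by
  simp [whippleTerm, legendreTerm]

theorem sum_legendreTerm_even (m : ℕ) :
    ∑ k ∈ Finset.range (2 * m + 1), legendreTerm (𝕜 := 𝕜) (2 * m) k =
      ∏ j ∈ Finset.range m, ((2 * j + 1 : 𝕜) / (2 * j + 2)) ^ 2 := by
  have := sum_whippleTerm_even (0 : 𝕜) m
    (fun j _ => by rw [sub_zero]; exact add_one_sq_ne_zero j)
  simpa only [whippleTerm_zero, sub_zero, div_pow] using this

theorem sum_legendreTerm_mul_even (m : ℕ) :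
    ∑ k ∈ Finset.range (2 * m + 1),
      legendreTerm (2 * m) k * ∑ j ∈ Finset.range k, 1 / (j + 1 : 𝕜) ^ 2 =
    (∏ j ∈ Finset.range m, ((2 * j + 1 : 𝕜) / (2 * j + 2)) ^ 2) *
      ∑ j ∈ Finset.range m, (1 / (2 * j + 2 : 𝕜) ^ 2 - 1 / (2 * j + 1 : 𝕜) ^ 2) := by
  have c1 : ∀ j : ℕ, (2 * j + 1 : 𝕜) ^ 2 ≠ 0 := fun j =>
    pow_ne_zero _ (by exact_mod_cast (by omega : 2 * j + 1 ≠ 0))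
  have c2 : ∀ j : ℕ, (2 * j + 2 : 𝕜) ^ 2 ≠ 0 := fun j =>
    pow_ne_zero _ (by exact_mod_cast (by omega : 2 * j + 2 ≠ 0))
  have hprod : HasLogDerivAt (fun e : 𝕜 => ∏ j ∈ Finset.range m,
      ((2 * j + 1 : 𝕜) ^ 2 + -1 * e) / ((2 * j + 2 : 𝕜) ^ 2 + -1 * e))
      (∑ j ∈ Finset.range m, (-1 / (2 * j + 1 : 𝕜) ^ 2 - -1 / (2 * j + 2 : 𝕜) ^ 2)) 0 :=
    HasLogDerivAt.prod _ _ _ fun j _ => (HasLogDerivAt.affine _ _ (c1 j)).div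
      (HasLogDerivAt.affine _ _ (c2 j)) (by simpa using c2 j)
  unfold HasLogDerivAt at hprod
  have heq : (fun e : 𝕜 => ∑ k ∈ Finset.range (2 * m + 1), whippleTerm e (2 * m) k) =ᶠ[𝓝 0]
      fun e : 𝕜 => ∏ j ∈ Finset.range m,
      ((2 * j + 1 : 𝕜) ^ 2 + -1 * e) / ((2 * j + 2 : 𝕜) ^ 2 + -1 * e) := by
    filter_upwards [eventually_add_one_sq_sub_ne_zero (2 * m)] with e he
    rw [sum_whippleTerm_even e m he]
    exact Finset.prod_congr rfl fun j _ => by ring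
  have := (hasDerivAt_sum_whippleTerm (𝕜 := 𝕜) (2 * m)).unique (hprod.congr_of_eventuallyEq heq)
  rw [this]
  simp only [mul_zero, add_zero, ← div_pow]
  congr 1
  exact Finset.sum_congr rfl fun j _ => by ring

theorem sum_legendreTerm_mul_odd (m : ℕ) :
    ∑ k ∈ Finset.range (2 * m + 2),
      legendreTerm (2 * m + 1) k * ∑ j ∈ Finset.range k, 1 / (j + 1 : 𝕜) ^ 2 =
    -∏ j ∈ Finset.range m, ((2 * j + 2 : 𝕜) / (2 * j + 3)) ^ 2 := by
  have c3 : ∀ j : ℕ, (2 * j + 3 : 𝕜) ^ 2 ≠ 0 := fun j =>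
    pow_ne_zero _ (by exact_mod_cast (by omega : 2 * j + 3 ≠ 0))
  have c2 : ∀ j : ℕ, (2 * j + 2 : 𝕜) ^ 2 ≠ 0 := fun j =>
    pow_ne_zero _ (by exact_mod_cast (by omega : 2 * j + 2 ≠ 0))
  have hprod : HasLogDerivAt (fun e : 𝕜 => -1 / (1 + -1 * e) * ∏ j ∈ Finset.range m,
      ((2 * j + 2 : 𝕜) ^ 2 + -1 * e) / ((2 * j + 3 : 𝕜) ^ 2 + -1 * e))
      ((0 - -1 / 1) + ∑ j ∈ Finset.range m, (-1 / (2 * j + 2 : 𝕜) ^ 2 - -1 / (2 * j + 3 : 𝕜) ^ 2)) 0 :=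
    ((HasLogDerivAt.const _).div (HasLogDerivAt.affine _ _ one_ne_zero) (by simp)).mul
    (HasLogDerivAt.prod _ _ _ fun j _ => (HasLogDerivAt.affine _ _ (c2 j)).div
      (HasLogDerivAt.affine _ _ (c3 j)) (by simpa using c3 j))
  -- The factor e is split off: it vanishes at 0, so the derivative there is the value of the
  -- cofactor, and the logarithmic derivative of the cofactor drops out.
  have hprod' := (hasDerivAt_id (0 : 𝕜)).fun_mul hprod
  have heq : (fun e : 𝕜 => ∑ k ∈ Finset.range (2 * m + 2), whippleTerm e (2 * m + 1) k) =ᶠ[𝓝 0]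
      fun e : 𝕜 => id e * (-1 / (1 + -1 * e) * ∏ j ∈ Finset.range m,
      ((2 * j + 2 : 𝕜) ^ 2 + -1 * e) / ((2 * j + 3 : 𝕜) ^ 2 + -1 * e)) := by
    filter_upwards [eventually_add_one_sq_sub_ne_zero (2 * m + 1)] with e he
    rw [sum_whippleTerm_odd e m he, ← mul_assoc]
    congr 1
    · simp only [id]; ring
    · exact Finset.prod_congr rfl fun j _ => by ring
  have := (hasDerivAt_sum_whippleTerm (𝕜 := 𝕜) (2 * m + 1)).unique
    (hprod'.congr_of_eventuallyEq heq)
  rw [this]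
  simp [div_pow]

end Derivatives

/-! ### Central binomial ratios and harmonic sums over a field -/

section Definitions

variable (K : Type*) [Field K]

/-- `∏_{j < k} (2j + 1) / (2j + 2) = C(2k, k) / 4 ^ k`. -/
def centralRatio (k : ℕ) : K := ∏ j ∈ Finset.range k, ((2 * j + 1 : K) / (2 * j + 2))

/-- `∑_{j ≤ k} 1 / j ^ 2`. -/
def harmonicTwo (k : ℕ) : K := ∑ j ∈ Finset.range k, 1 / (j + 1 : K) ^ 2

/-- `∑_{j ≤ k} 1 / (2j - 1) ^ r`. -/
def oddSum (r k : ℕ) : K := ∑ j ∈ Finset.range k, 1 / (2 * j + 1 : K) ^ r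

end Definitions

/-! ### Evaluations modulo p -/

section Residues

variable {p : ℕ} [Fact p.Prime]

theorem natCast_zmod_ne_zero {k : ℕ} (h0 : 0 < k) (h : k < p) : (k : ZMod p) ≠ 0 := by
  rw [Ne, ZMod.natCast_eq_zero_iff]
  exact fun hd => absurd (Nat.le_of_dvd h0 hd) (by omega)

theorem factorial_zmod_ne_zero {k : ℕ} (h : k < p) : (k.factorial : ZMod p) ≠ 0 := by
  rw [Ne, ZMod.natCast_eq_zero_iff, (Fact.out : p.Prime).dvd_factorial]
  omega

theorem two_zmod_ne_zero (hp : 2 < p) : (2 : ZMod p) ≠ 0 := by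
  exact_mod_cast natCast_zmod_ne_zero (p := p) (k := 2) (by omega) hp

/-- Wilson's theorem with the upper b factors of (p-1)! replaced by their negatives modulo p. -/
theorem factorial_mul_factorial_zmod {a b : ℕ} (h : p = a + b + 1) :
    (a.factorial * b.factorial * (-1) ^ b : ZMod p) = -1 := by
  have hw := ZMod.wilsons_lemma p
  have e : p - 1 = a + b := by omega
  rw [e, ← Finset.prod_range_add_one_eq_factorial, Finset.prod_range_add,
    Finset.prod_range_add_one_eq_factorial] at hw
  rw [Nat.cast_mul] at hw
  refine Eq.trans ?_ hw
  rw [mul_assoc]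
  congr 1
  rw [← Finset.prod_range_reflect, ← Finset.prod_range_add_one_eq_factorial]
  push_cast
  have hc : (-1 : ZMod p) ^ b = ∏ _j ∈ Finset.range b, (-1) := by simp
  rw [hc, ← Finset.prod_mul_distrib]
  refine Finset.prod_congr rfl fun j hj => ?_
  have hj := Finset.mem_range.1 hj
  have hp0 : ((a + b + 1 : ℕ) : ZMod p) = 0 := by rw [← h]; exact ZMod.natCast_self p
  have : ((b - 1 - j : ℕ) : ZMod p) = b - 1 - j := by
    rw [Nat.sub_sub, Nat.cast_sub (by omega)]; push_cast; ring
  rw [this]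
  push_cast at hp0
  linear_combination -hp0

theorem sum_univ_zmod_eq_sum_range (f : ZMod p → ZMod p) :
    ∑ x : ZMod p, f x = ∑ k ∈ Finset.range p, f k := by
  symm
  refine Finset.sum_bij' (fun k _ => (k : ZMod p)) (fun x _ => x.val) (by simp)
    (fun x _ => Finset.mem_range.2 (ZMod.val_lt x)) ?_ (by simp) (by simp)
  intro k hk
  exact ZMod.val_cast_of_lt (Finset.mem_range.1 hk)

/-- Doubling permutes `ZMod p`, so the sum S satisfies 4S = S, and 3 is invertible. The term x = 0
contributes 0⁻¹ = 0. -/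
theorem sum_inv_sq_zmod (hp : 3 < p) : ∑ x : ZMod p, (x ^ 2)⁻¹ = 0 := by
  have h2 : (2 : ZMod p) ≠ 0 := two_zmod_ne_zero (by omega)
  have h3 : (3 : ZMod p) ≠ 0 := by
    exact_mod_cast natCast_zmod_ne_zero (p := p) (k := 3) (by omega) hp
  have h : ∑ x : ZMod p, (x ^ 2)⁻¹ = ∑ x : ZMod p, ((2 * x) ^ 2)⁻¹ :=
    (Fintype.sum_equiv (Equiv.mulLeft₀ 2 h2) _ _ fun x => rfl).symm
  simp only [mul_pow, mul_inv] at h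
  rw [← Finset.mul_sum] at h
  have : (3 : ZMod p) * ∑ x : ZMod p, (x ^ 2)⁻¹ = 0 := by
    have e : (2 : ZMod p) ^ 2 * (2 ^ 2)⁻¹ = 1 := mul_inv_cancel₀ (pow_ne_zero _ h2)
    linear_combination 2 ^ 2 * h + (∑ x : ZMod p, (x ^ 2)⁻¹) * e
  exact (mul_eq_zero.1 this).resolve_left h3

variable {n : ℕ}

theorem two_mul_half_zmod (h : p = 2 * n + 1) : (2 * n : ZMod p) = -1 := by
  have hp0 : ((2 * n + 1 : ℕ) : ZMod p) = 0 := by rw [← h]; exact ZMod.natCast_self p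
  push_cast at hp0
  linear_combination hp0

theorem odd_zmod_ne_zero (h : p = 2 * n + 1) {j : ℕ} (hj : j < n) : (2 * j + 1 : ZMod p) ≠ 0 := by
  exact_mod_cast natCast_zmod_ne_zero (p := p) (k := 2 * j + 1) (by omega) (by omega)

theorem add_one_zmod_ne_zero {j : ℕ} (hj : j + 1 < p) : (j + 1 : ZMod p) ≠ 0 := by
  exact_mod_cast natCast_zmod_ne_zero (p := p) (k := j + 1) (by omega) (by omega)

theorem harmonicTwo_half_zmod (h : p = 2 * n + 1) (hp : 3 < p) : harmonicTwo (ZMod p) n = 0 := by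
  have h0 := sum_inv_sq_zmod hp
  rw [sum_univ_zmod_eq_sum_range] at h0
  have e : Finset.range p = Finset.range (2 * n + 1) := by rw [h]
  rw [e, Finset.sum_range_succ'] at h0
  rw [two_mul, Finset.sum_range_add, ← Finset.sum_range_reflect _ n] at h0
  have : ∑ j ∈ Finset.range n, (((n - 1 - j + 1 : ℕ) : ZMod p) ^ 2)⁻¹ = harmonicTwo (ZMod p) n := by
    unfold harmonicTwo
    rw [← Finset.sum_range_reflect (fun j : ℕ => 1 / ((j : ZMod p) + 1) ^ 2)]
    exact Finset.sum_congr rfl fun j _ => by push_cast; rw [one_div]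
  rw [this] at h0
  have h1 : ∑ j ∈ Finset.range n, (((n + j + 1 : ℕ) : ZMod p) ^ 2)⁻¹ = harmonicTwo (ZMod p) n := by
    unfold harmonicTwo
    rw [← Finset.sum_range_reflect]
    refine Finset.sum_congr rfl fun j hj => ?_
    have hj := Finset.mem_range.1 hj
    have e1 : ((n - 1 - j : ℕ) : ZMod p) = n - 1 - j := by
      rw [Nat.sub_sub, Nat.cast_sub (by omega)]; push_cast; ring
    rw [one_div]
    congr 1
    push_cast
    rw [e1]
    linear_combination (2 * n - 2 * j - 1 : ZMod p) * two_mul_half_zmod h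
  rw [h1] at h0
  have h2 : (2 : ZMod p) ≠ 0 := two_zmod_ne_zero (by omega)
  have : (2 : ZMod p) * harmonicTwo (ZMod p) n = 0 := by simpa [two_mul] using h0
  exact (mul_eq_zero.1 this).resolve_left h2

/-- Since 2j+1 ≡ -2(n-j), each odd reciprocal square added on the left removes the top term of
H^{(2)} on the right. The induction starts from H_n^{(2)} ≡ 0. -/
theorem four_mul_oddSum_zmod (h : p = 2 * n + 1) (hp : 3 < p) {k : ℕ} (hk : k ≤ n) :
    4 * oddSum (ZMod p) 2 k = -harmonicTwo (ZMod p) (n - k) := by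
  induction k with
  | zero => simp [oddSum, harmonicTwo_half_zmod h hp]
  | succ k ih =>
    have ih := ih (by omega)
    obtain ⟨l, hl⟩ : ∃ l, n = k + 1 + l := Nat.exists_eq_add_of_le hk
    have e1 : n - k = l + 1 := by omega
    have e2 : n - (k + 1) = l := by omega
    rw [e1] at ih
    rw [e2]
    unfold oddSum harmonicTwo at *
    rw [Finset.sum_range_succ, mul_add, ih, Finset.sum_range_succ]
    have n1 := odd_zmod_ne_zero h (j := k) (by omega)
    have e3 : (l + 1 : ZMod p) = -(2 * k + 1) / 2 := by
      have := two_mul_half_zmod h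
      have h2 : (2 : ZMod p) ≠ 0 := two_zmod_ne_zero (by omega)
      rw [hl] at this
      push_cast at this
      rw [eq_div_iff h2]
      linear_combination this
    rw [e3]
    field_simp
    ring

theorem centralRatio_half_zmod (h : p = 2 * n + 1) :
    centralRatio (ZMod p) n = (-1) ^ n := by
  unfold centralRatio
  rw [Finset.prod_div_distrib, ← Finset.prod_range_reflect, ← Finset.prod_div_distrib]
  nth_rewrite 3 [← Finset.card_range n]
  rw [← Finset.prod_const]
  refine Finset.prod_congr rfl fun j hj => ?_
  have hj := Finset.mem_range.1 hj
  have e1 : ((n - 1 - j : ℕ) : ZMod p) = n - 1 - j := by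
    rw [Nat.sub_sub, Nat.cast_sub (by omega)]; push_cast; ring
  have n1 : (2 * j + 2 : ZMod p) ≠ 0 := by
    exact_mod_cast natCast_zmod_ne_zero (p := p) (k := 2 * j + 2) (by omega) (by omega)
  rw [e1, div_eq_iff n1]
  linear_combination two_mul_half_zmod h

/-- With k + l + 1 = n one has 2k+1 ≡ -(2l+2) and 2k+2 ≡ -(2l+1), so c_{k+1}/c_k and c_{l+1}/c_l are
inverse to each other. -/
theorem centralRatio_reflect_zmod (h : p = 2 * n + 1) {k : ℕ} (hk : k ≤ n) :
    centralRatio (ZMod p) (n - k) = (-1) ^ n * centralRatio (ZMod p) k := by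
  induction k with
  | zero => rw [Nat.sub_zero, centralRatio_half_zmod h]; simp [centralRatio]
  | succ k ih =>
    have ih := ih (by omega)
    obtain ⟨l, hl⟩ : ∃ l, n = k + 1 + l := Nat.exists_eq_add_of_le hk
    have e1 : n - k = l + 1 := by omega
    have e2 : n - (k + 1) = l := by omega
    rw [e1] at ih
    rw [e2]
    unfold centralRatio at *
    rw [Finset.prod_range_succ] at ih
    rw [Finset.prod_range_succ, ← mul_assoc, ← ih]
    have n1 := odd_zmod_ne_zero h (j := l) (by omega)
    have n2 : (2 * k + 2 : ZMod p) ≠ 0 := by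
      exact_mod_cast natCast_zmod_ne_zero (p := p) (k := 2 * k + 2) (by omega) (by omega)
    have n3 : (2 * l + 2 : ZMod p) ≠ 0 := by
      exact_mod_cast natCast_zmod_ne_zero (p := p) (k := 2 * l + 2) (by omega) (by omega)
    have := two_mul_half_zmod h
    rw [hl] at this
    push_cast at this
    have e3 : (2 * k + 1 : ZMod p) = -(2 * l + 2) := by linear_combination this
    have e4 : (2 * k + 2 : ZMod p) = -(2 * l + 1) := by linear_combination this
    rw [e3, e4, neg_div_neg_eq, mul_assoc, div_mul_div_cancel₀ n3, div_self n1, mul_one]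

theorem sum_centralRatio_mul_oddSum_zmod (h : p = 2 * n + 1) (hp : 3 < p) :
    4 * ∑ k ∈ Finset.range (n + 1), centralRatio (ZMod p) k ^ 3 * oddSum (ZMod p) 2 k =
      -(-1) ^ n * ∑ k ∈ Finset.range (n + 1), centralRatio (ZMod p) k ^ 3 * harmonicTwo (ZMod p) k := by
  rw [← Finset.sum_range_reflect (fun k => centralRatio (ZMod p) k ^ 3 * harmonicTwo (ZMod p) k),
    Finset.mul_sum, Finset.mul_sum]
  refine Finset.sum_congr rfl fun k hk => ?_
  have hk : k ≤ n := by have := Finset.mem_range.1 hk; omega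
  have e : n + 1 - 1 - k = n - k := by omega
  rw [e, centralRatio_reflect_zmod h hk]
  have e2 : ((-1 : ZMod p) ^ n) ^ 4 = 1 := by
    rw [← pow_mul, mul_comm, pow_mul]; norm_num
  linear_combination centralRatio (ZMod p) k ^ 3 * four_mul_oddSum_zmod h hp hk +
    (centralRatio (ZMod p) k ^ 3 * harmonicTwo (ZMod p) (n - k)) * e2

theorem reduces_centralRatio (h : p = 2 * n + 1) {k : ℕ} (hk : k ≤ n) :
    Reduces (centralRatio ℚ_[p] k) (centralRatio (ZMod p) k) := by
  refine Reduces.prod _ _ _ fun j hj => ?_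
  have hj := Finset.mem_range.1 hj
  have n2 : (2 * j + 2 : ZMod p) ≠ 0 := by
    exact_mod_cast natCast_zmod_ne_zero (p := p) (k := 2 * j + 2) (by omega) (by omega)
  exact ((((Reduces.ofNat 2).mul (Reduces.natCast j)).add Reduces.one).div
    (((Reduces.ofNat 2).mul (Reduces.natCast j)).add (Reduces.ofNat 2)) n2)

theorem reduces_harmonicTwo {k : ℕ} (hk : k < p) :
    Reduces (harmonicTwo ℚ_[p] k) (harmonicTwo (ZMod p) k) := by
  refine Reduces.sum _ _ _ fun j hj => ?_
  have hj := Finset.mem_range.1 hj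
  exact Reduces.one.div (((Reduces.natCast j).add Reduces.one).pow 2)
    (pow_ne_zero _ (add_one_zmod_ne_zero (by omega)))

theorem reduces_oddSum (h : p = 2 * n + 1) (r : ℕ) {k : ℕ} (hk : k ≤ n) :
    Reduces (oddSum ℚ_[p] r k) (oddSum (ZMod p) r k) := by
  refine Reduces.sum _ _ _ fun j hj => ?_
  have hj := Finset.mem_range.1 hj
  exact Reduces.one.div ((((Reduces.ofNat 2).mul (Reduces.natCast j)).add Reduces.one).pow r)
    (pow_ne_zero _ (odd_zmod_ne_zero h (by omega)))

/-- Both -n and n+1 are 1/2 modulo p, so all three upper parameters agree. -/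
theorem reduces_legendreTerm (h : p = 2 * n + 1) (hp : 3 < p) {k : ℕ} (hk : k ≤ n) :
    Reduces (legendreTerm n k : ℚ_[p]) (centralRatio (ZMod p) k ^ 3) := by
  unfold legendreTerm poch centralRatio
  rw [← Finset.prod_mul_distrib, ← Finset.prod_mul_distrib, ← Finset.prod_mul_distrib,
    ← Finset.prod_div_distrib, ← Finset.prod_pow]
  refine Reduces.prod _ _ _ fun j hj => ?_
  have hj := Finset.mem_range.1 hj
  have h2 : (2 : ZMod p) ≠ 0 := two_zmod_ne_zero (by omega)
  have n1 : (j + 1 : ZMod p) ≠ 0 := add_one_zmod_ne_zero (by omega)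
  have n1' : (1 + j : ZMod p) ≠ 0 := by rwa [add_comm]
  have n2 : (2 * j + 2 : ZMod p) ≠ 0 := by
    exact_mod_cast natCast_zmod_ne_zero (p := p) (k := 2 * j + 2) (by omega) (by omega)
  have key :=
    Reduces.div ((((Reduces.natCast n).neg.add (Reduces.natCast j)).mul
      (((Reduces.natCast n).add Reduces.one).add (Reduces.natCast j))).mul
      ((Reduces.one.div (Reduces.ofNat 2) h2).add (Reduces.natCast j)))
      ((Reduces.one.add (Reduces.natCast j)).mul
      (((Reduces.natCast j).add Reduces.one).pow 2))
      (mul_ne_zero n1' (pow_ne_zero 2 n1))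
  convert key using 1
  have e : (n : ZMod p) = -1 / 2 := by
    rw [eq_div_iff h2]; linear_combination two_mul_half_zmod h
  have n3 : (2 * j + 2 : ZMod p) = 2 * (j + 1) := by ring
  rw [e, n3, add_comm (1 : ZMod p) j]
  field_simp
  ring

theorem sum_centralRatio_cube_zmod {m : ℕ} (h : p = 2 * (2 * m) + 1) (hp : 3 < p) :
    ∑ k ∈ Finset.range (2 * m + 1), centralRatio (ZMod p) k ^ 3 = centralRatio (ZMod p) m ^ 2 := by
  have h1 : Reduces (∑ k ∈ Finset.range (2 * m + 1), (legendreTerm (2 * m) k : ℚ_[p]))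
      (∑ k ∈ Finset.range (2 * m + 1), centralRatio (ZMod p) k ^ 3) :=
    Reduces.sum _ _ _ fun k hk => reduces_legendreTerm h hp
      (by have := Finset.mem_range.1 hk; omega)
  rw [sum_legendreTerm_even, Finset.prod_pow] at h1
  exact h1.unique ((reduces_centralRatio h (by omega)).pow 2)

/-- The differentiated Whipple sum gives c_m^2 (H_m^{(2)}/4 - O_m^{(2)}). As m is the fixed point of
k ↦ n-k, O_m^{(2)} ≡ -H_m^{(2)}/4 and the two parts add. -/
theorem sum_centralRatio_mul_harmonicTwo_even_zmod {m : ℕ} (h : p = 2 * (2 * m) + 1) (hp : 3 < p) :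
    2 * ∑ k ∈ Finset.range (2 * m + 1), centralRatio (ZMod p) k ^ 3 * harmonicTwo (ZMod p) k =
      centralRatio (ZMod p) m ^ 2 * harmonicTwo (ZMod p) m := by
  have h1 : Reduces (∑ k ∈ Finset.range (2 * m + 1),
      (legendreTerm (2 * m) k : ℚ_[p]) * harmonicTwo ℚ_[p] k)
      (∑ k ∈ Finset.range (2 * m + 1), centralRatio (ZMod p) k ^ 3 * harmonicTwo (ZMod p) k) :=
    Reduces.sum _ _ _ fun k hk => by
      have := Finset.mem_range.1 hk
      exact (reduces_legendreTerm h hp (by omega)).mul (reduces_harmonicTwo (by omega))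
  unfold harmonicTwo at h1
  rw [sum_legendreTerm_mul_even, Finset.prod_pow, Finset.sum_sub_distrib] at h1
  have h2 : (2 : ZMod p) ≠ 0 := two_zmod_ne_zero (by omega)
  have e1 : ∑ j ∈ Finset.range m, 1 / (2 * j + 2 : ℚ_[p]) ^ 2 = harmonicTwo ℚ_[p] m / 2 ^ 2 := by
    unfold harmonicTwo
    rw [Finset.sum_div]
    refine Finset.sum_congr rfl fun j _ => ?_
    rw [div_div]; ring_nf
  rw [e1] at h1
  have h3 := h1.unique (((reduces_centralRatio h (by omega)).pow 2).mul
    (((reduces_harmonicTwo (p := p) (k := m) (by omega)).div ((Reduces.ofNat 2).pow 2)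
      (pow_ne_zero _ h2)).sub (reduces_oddSum h 2 (by omega))))
  have h4 := four_mul_oddSum_zmod h hp (k := m) (by omega)
  have e2 : 2 * m - m = m := by omega
  rw [e2] at h4
  have e3 : oddSum (ZMod p) 2 m = -harmonicTwo (ZMod p) m / 2 ^ 2 := by
    rw [eq_div_iff (pow_ne_zero _ h2)]; linear_combination h4
  rw [e3] at h3
  unfold harmonicTwo at h3 ⊢
  rw [h3]
  field_simp
  ring

theorem two_pow_zmod (hp : 3 < p) : (2 : ZMod p) ^ (p - 1) = 1 :=
  ZMod.pow_card_sub_one_eq_one (two_zmod_ne_zero (by omega))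

theorem prod_odd_mul_factorial {K : Type*} [Field K] (m : ℕ) :
    (∏ j ∈ Finset.range m, (2 * j + 1 : K)) * (2 ^ m * m.factorial) = (2 * m).factorial := by
  induction m with
  | zero => simp
  | succ m ih =>
    rw [Finset.prod_range_succ, Nat.factorial_succ, show 2 * (m + 1) = 2 * m + 1 + 1 by ring,
      Nat.factorial_succ, Nat.factorial_succ]
    push_cast
    rw [← ih]
    ring

theorem prod_even {K : Type*} [Field K] (m : ℕ) :
    (∏ j ∈ Finset.range m, (2 * j + 2 : K)) = 2 ^ m * m.factorial := by
  induction m with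
  | zero => simp
  | succ m ih =>
    rw [Finset.prod_range_succ, Nat.factorial_succ, ih]
    push_cast
    ring

/-- The differentiated Whipple sum is -(4^m m!^2 / (2m+1)!)^2. Here (2m+1)!^2 ≡ 1 by Wilson, and
2^{4m+2} = 2^{p-1} ≡ 1. -/
theorem sum_centralRatio_mul_harmonicTwo_odd_zmod {m : ℕ} (h : p = 2 * (2 * m + 1) + 1)
    (hp : 3 < p) :
    4 * ∑ k ∈ Finset.range (2 * m + 2), centralRatio (ZMod p) k ^ 3 * harmonicTwo (ZMod p) k =
      -(m.factorial : ZMod p) ^ 4 := by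
  have h1 : Reduces (∑ k ∈ Finset.range (2 * m + 2),
      (legendreTerm (2 * m + 1) k : ℚ_[p]) * harmonicTwo ℚ_[p] k)
      (∑ k ∈ Finset.range (2 * m + 2), centralRatio (ZMod p) k ^ 3 * harmonicTwo (ZMod p) k) :=
    Reduces.sum _ _ _ fun k hk => by
      have := Finset.mem_range.1 hk
      exact (reduces_legendreTerm h hp (by omega)).mul (reduces_harmonicTwo (by omega))
  have h2 : (2 : ZMod p) ≠ 0 := two_zmod_ne_zero (by omega)
  have c3 : ∀ j ∈ Finset.range m, (2 * j + 3 : ZMod p) ≠ 0 := fun j hj => by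
    have := Finset.mem_range.1 hj
    exact_mod_cast natCast_zmod_ne_zero (p := p) (k := 2 * j + 3) (by omega) (by omega)
  unfold harmonicTwo at h1
  rw [sum_legendreTerm_mul_odd] at h1
  have h3 := h1.unique (Reduces.neg (Reduces.prod _ _
    (fun j : ℕ => ((2 * j + 2 : ZMod p) / (2 * j + 3 : ZMod p)) ^ 2) fun j hj =>
      ((((Reduces.ofNat 2).mul (Reduces.natCast j)).add (Reduces.ofNat 2)).div
        (((Reduces.ofNat 2).mul (Reduces.natCast j)).add (Reduces.ofNat 3)) (c3 j hj)).pow 2))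
  unfold harmonicTwo
  rw [h3, Finset.prod_pow, Finset.prod_div_distrib, prod_even]
  have h4 := prod_odd_mul_factorial (K := ZMod p) (m + 1)
  rw [Finset.prod_range_succ'] at h4
  have e : ∏ j ∈ Finset.range m, (2 * ((j + 1 : ℕ) : ZMod p) + 1) =
      ∏ j ∈ Finset.range m, (2 * j + 3 : ZMod p) :=
    Finset.prod_congr rfl fun j _ => by push_cast; ring
  rw [e, show 2 * (m + 1) = 2 * m + 1 + 1 by ring, Nat.factorial_succ] at h4
  rw [Nat.factorial_succ (2 * m + 1)] at h4
  push_cast at h4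
  have n1 : ∏ j ∈ Finset.range m, (2 * j + 3 : ZMod p) ≠ 0 := Finset.prod_ne_zero_iff.2 c3
  have n2 : (m + 1 : ZMod p) ≠ 0 := add_one_zmod_ne_zero (by omega)
  have h5 := factorial_mul_factorial_zmod (p := p) (a := 2 * m + 1) (b := 2 * m + 1) (by omega)
  rw [Odd.neg_one_pow ⟨m, rfl⟩] at h5
  have h6 : (∏ j ∈ Finset.range m, (2 * j + 3 : ZMod p)) * (2 ^ m * m.factorial) =
      (2 * m + 1).factorial := by
    have : (2 * (m + 1) : ZMod p) ≠ 0 := mul_ne_zero h2 n2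
    apply mul_left_cancel₀ this
    linear_combination h4
  have h7 := two_pow_zmod hp
  rw [show p - 1 = m * 4 + 2 by omega, pow_add, pow_mul] at h7
  rw [← h6] at h5
  field_simp
  generalize (∏ j ∈ Finset.range m, (2 * j + 3 : ZMod p)) = P at *
  generalize (2 : ZMod p) ^ m = t at *
  generalize (m.factorial : ZMod p) = f at *
  linear_combination -4 * t ^ 2 * f ^ 2 * h5 - f ^ 4 * P ^ 2 * h7

end Residues

/-! ### Euler numbers modulo p -/

section Euler

/-- Coefficient of t^m in (1/cosh t) · cosh t = 1, multiplied by m!. The coefficient of E_m is 1, so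
this determines the Euler numbers without division. -/
theorem sum_eulerNumber (m : ℕ) :
    ∑ j ∈ Finset.range (m + 1), (if Even (m - j) then (m.choose j : ℚ) else 0) * eulerNumber j =
      0 ^ m := by
  have hc : PowerSeries.constantCoeff coshSeries ≠ 0 := by
    rw [← PowerSeries.coeff_zero_eq_constantCoeff_apply]
    simp [coshSeries]
  have h := congrArg (PowerSeries.coeff m) (PowerSeries.inv_mul_cancel coshSeries hc)
  rw [PowerSeries.coeff_mul, PowerSeries.coeff_one,
    Finset.Nat.sum_antidiagonal_eq_sum_range_succ
      (fun i j => PowerSeries.coeff i coshSeries⁻¹ * PowerSeries.coeff j coshSeries)] at h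
  have h2 := congrArg (fun x => (m.factorial : ℚ) * x) h
  rw [Finset.mul_sum] at h2
  have hr : (m.factorial : ℚ) * (if m = 0 then 1 else 0) = 0 ^ m := by
    rcases eq_or_ne m 0 with rfl | hm
    · simp
    · simp [hm]
  rw [← hr, ← h2]
  refine Finset.sum_congr rfl fun j hj => ?_
  have hj : j ≤ m := by have := Finset.mem_range.1 hj; omega
  simp only [coshSeries, PowerSeries.coeff_mk, eulerNumber]
  split_ifs
  · have hch := Nat.choose_mul_factorial_mul_factorial hj
    have hch' : (m.choose j : ℚ) * j.factorial * (m - j).factorial = m.factorial := by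
      exact_mod_cast hch
    rw [← hch']
    have : ((m - j).factorial : ℚ) ≠ 0 := by exact_mod_cast Nat.factorial_ne_zero _
    field_simp
  · simp

theorem sum_range_alternating {R : Type*} [CommRing R] (g : ℕ → R) (N : ℕ) :
    ∑ t ∈ Finset.range N, (-1) ^ t * (g (t + 1) + g t) = g 0 - (-1) ^ N * g N := by
  induction N with
  | zero => simp
  | succ N ih => rw [Finset.sum_range_succ, ih]; ring

variable {p : ℕ} [Fact p.Prime]

/-- The alternating sum of `m`-th powers of the first `p` odd numbers, modulo `p`. -/
def alternatingPowerSum (p m : ℕ) : ZMod p :=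
  ∑ t ∈ Finset.range p, (-1) ^ t * (2 * t + 1 : ZMod p) ^ m

/-- The Euler recurrence: twice the even part of the binomial expansion is ((2t+1)+1)^m +
((2t+1)-1)^m = (2t+2)^m + (2t)^m, and its alternating sum telescopes. -/
theorem sum_alternatingPowerSum (hp : 3 < p) (m : ℕ) :
    ∑ j ∈ Finset.range (m + 1), (if Even (m - j) then (m.choose j : ZMod p) else 0) *
      alternatingPowerSum p j = 0 ^ m := by
  have h2 : (2 : ZMod p) ≠ 0 := two_zmod_ne_zero (by omega)
  have hodd : Odd p := (Fact.out : p.Prime).odd_of_ne_two (by omega)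
  unfold alternatingPowerSum
  apply mul_left_cancel₀ h2
  simp only [Finset.mul_sum]
  rw [Finset.sum_comm]
  have key := sum_range_alternating (fun t => (2 * t : ZMod p) ^ m) p
  rw [hodd.neg_one_pow] at key
  simp only [CharP.cast_eq_zero, mul_zero, Nat.cast_zero] at key
  -- Both endpoints t = 0 and t = p contribute 0^m, and (-1)^p = -1 makes them add.
  rw [show (2 * 0 ^ m : ZMod p) = 0 ^ m - -1 * 0 ^ m by ring, ← key]
  refine Finset.sum_congr rfl fun t _ => ?_
  have e1 : (2 * ((t + 1 : ℕ) : ZMod p)) = (2 * t + 1) + 1 := by push_cast; ring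
  have e2 : (2 * t : ZMod p) = (2 * t + 1) + -1 := by ring
  rw [e1]
  nth_rewrite 3 [e2]
  rw [add_pow, add_pow, ← Finset.sum_add_distrib, Finset.mul_sum]
  refine Finset.sum_congr rfl fun j _ => ?_
  split_ifs with he
  · rw [he.neg_one_pow, one_pow]; ring
  · rw [(Nat.not_even_iff_odd.1 he).neg_one_pow, one_pow]; ring

theorem reduces_eulerNumber (hp : 3 < p) (m : ℕ) :
    Reduces (eulerNumber m : ℚ_[p]) (alternatingPowerSum p m) := by
  induction m using Nat.strong_induction_on with
  | _ m ih =>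
    have h1 := congrArg (Rat.cast : ℚ → ℚ_[p]) (sum_eulerNumber m)
    have h2 := sum_alternatingPowerSum hp m
    rw [Finset.sum_range_succ] at h1 h2
    simp only [Nat.sub_self, Even.zero, if_true, Nat.choose_self, Nat.cast_one, one_mul] at h1 h2
    push_cast at h1
    rw [← eq_sub_iff_add_eq'] at h1 h2
    rw [h1, h2]
    refine (Reduces.zero.pow m).sub (Reduces.sum _ _ _ fun j hj => Reduces.mul ?_
      (ih j (Finset.mem_range.1 hj)))
    split_ifs
    · simpa using Reduces.natCast (p := p) (m.choose j)
    · simpa using Reduces.zero (p := p)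

/-- Fermat's little theorem for x ≠ 0; at x = 0 the exponent is positive and 0⁻¹ = 0. -/
theorem zmod_pow_sub_three (hp : 3 < p) (x : ZMod p) : x ^ (p - 3) = (x ^ 2)⁻¹ := by
  rcases eq_or_ne x 0 with rfl | hx
  · rw [zero_pow (by omega)]; simp
  · refine eq_inv_of_mul_eq_one_left ?_
    rw [← pow_add, show p - 3 + 2 = p - 1 by omega]
    exact ZMod.pow_card_sub_one_eq_one hx

theorem sum_range_alternating_inv_sq (K : Type*) [Field K] (m : ℕ) :
    ∑ i ∈ Finset.range (2 * m), (-1) ^ (i + 1) * ((i + 1 : K) ^ 2)⁻¹ =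
      harmonicTwo K m / 4 - oddSum K 2 m := by
  induction m with
  | zero => simp [harmonicTwo, oddSum]
  | succ m ih =>
    rw [show 2 * (m + 1) = 2 * m + 1 + 1 by ring, Finset.sum_range_succ, Finset.sum_range_succ, ih]
    unfold harmonicTwo oddSum
    rw [Finset.sum_range_succ, Finset.sum_range_succ]
    have e1 : (-1 : K) ^ (2 * m + 1) = -1 := Odd.neg_one_pow ⟨m, rfl⟩
    have e2 : ((2 * m + 1 : ℕ) + 1 : K) = 2 * (m + 1) := by push_cast; ring
    have e3 : (2 ^ 2 : K) = 4 := by norm_num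
    rw [pow_succ _ (2 * m + 1), e1, e2, mul_pow, mul_inv, e3]
    push_cast
    rw [one_div, one_div]
    ring

/-- The numbers 2t+1 run symmetrically around p, reached at t = 2m. Modulo p they are ±2(i+1), so
each half is a quarter of the alternating sum of inverse squares up to 2m. -/
theorem alternatingPowerSum_eq {m : ℕ} (h : p = 2 * (2 * m) + 1) (hp : 3 < p) :
    4 * alternatingPowerSum p (p - 3) = harmonicTwo (ZMod p) m := by
  have h2 : (2 : ZMod p) ≠ 0 := two_zmod_ne_zero (by omega)
  have hm := two_mul_half_zmod h
  have ho := four_mul_oddSum_zmod h hp (k := m) (by omega)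
  rw [show 2 * m - m = m by omega] at ho
  have halt := sum_range_alternating_inv_sq (ZMod p) m
  unfold alternatingPowerSum
  simp only [zmod_pow_sub_three hp]
  have e : Finset.range p = Finset.range ((2 * m + 1) + 2 * m) := by congr 1; omega
  rw [e, Finset.sum_range_add, Finset.sum_range_succ, ← Finset.sum_range_reflect]
  have e1 : ∑ j ∈ Finset.range (2 * m), (-1) ^ (2 * m - 1 - j) *
      ((2 * ((2 * m - 1 - j : ℕ) : ZMod p) + 1) ^ 2)⁻¹ =
      (4 : ZMod p)⁻¹ * ∑ i ∈ Finset.range (2 * m), (-1) ^ (i + 1) * ((i + 1 : ZMod p) ^ 2)⁻¹ := by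
    rw [Finset.mul_sum]
    refine Finset.sum_congr rfl fun j hj => ?_
    have hj := Finset.mem_range.1 hj
    have c1 : ((2 * m - 1 - j : ℕ) : ZMod p) = 2 * m - 1 - j := by
      rw [Nat.sub_sub, Nat.cast_sub (by omega)]; push_cast; ring
    have c2 : (-1 : ZMod p) ^ (2 * m - 1 - j) = (-1) ^ (j + 1) := by
      rw [neg_one_pow_eq_pow_mod_two, neg_one_pow_eq_pow_mod_two (n := j + 1)]
      congr 1; omega
    have c3 : (2 * (2 * m - 1 - j) + 1 : ZMod p) ^ 2 = 4 * (j + 1) ^ 2 := by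
      push_cast at hm
      have : (2 * (2 * m - 1 - j) + 1 : ZMod p) = -2 * (j + 1) := by linear_combination hm
      rw [this]; ring
    rw [c1, c2, c3, mul_inv]
    ring
  have e2 : ∑ j ∈ Finset.range (2 * m), (-1) ^ (2 * m + 1 + j) *
      ((2 * ((2 * m + 1 + j : ℕ) : ZMod p) + 1) ^ 2)⁻¹ =
      (4 : ZMod p)⁻¹ * ∑ i ∈ Finset.range (2 * m), (-1) ^ (i + 1) * ((i + 1 : ZMod p) ^ 2)⁻¹ := by
    rw [Finset.mul_sum]
    refine Finset.sum_congr rfl fun j hj => ?_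
    have c2 : (-1 : ZMod p) ^ (2 * m + 1 + j) = (-1) ^ (j + 1) := by
      rw [neg_one_pow_eq_pow_mod_two, neg_one_pow_eq_pow_mod_two (n := j + 1)]
      congr 1; omega
    have c3 : (2 * ((2 * m + 1 + j : ℕ) : ZMod p) + 1 : ZMod p) ^ 2 = 4 * (j + 1) ^ 2 := by
      push_cast at hm ⊢
      have : (2 * (2 * m + 1 + j) + 1 : ZMod p) = 2 * (j + 1) := by linear_combination hm
      rw [this]; ring
    rw [c2, c3, mul_inv]
    ring
  -- The middle term contributes 0⁻¹ = 0.
  have e3 : (2 * ((2 * m : ℕ) : ZMod p) + 1) = 0 := by rw [hm]; ring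
  rw [e1, e2, e3, halt]
  have h4 : (4 : ZMod p) ≠ 0 := by
    rw [show (4 : ZMod p) = 2 ^ 2 by norm_num]; exact pow_ne_zero _ h2
  field_simp
  simp only [ne_eq, OfNat.ofNat_ne_zero, not_false_eq_true, zero_pow, div_zero]
  linear_combination -2 * ho

/-- As 4m ≡ -1, the numbers 4j+3 on either side of j = m are ±2(2i+1), so each half gives
O_m^{(2)}/4. -/
theorem sum_four_mul_add_three_zmod {m : ℕ} (h : p = 2 * (2 * m) + 1) (hp : 3 < p) :
    8 * ∑ j ∈ Finset.range (2 * m), 1 / (4 * j + 3 : ZMod p) ^ 2 = -harmonicTwo (ZMod p) m := by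
  have hm := two_mul_half_zmod h
  push_cast at hm
  have ho := four_mul_oddSum_zmod h hp (k := m) (by omega)
  rw [show 2 * m - m = m by omega] at ho
  have h2 : (2 : ZMod p) ≠ 0 := two_zmod_ne_zero (by omega)
  have h4 : (4 : ZMod p) ≠ 0 := by
    rw [show (4 : ZMod p) = 2 ^ 2 by norm_num]; exact pow_ne_zero _ h2
  rw [← ho, two_mul m, Finset.sum_range_add, ← Finset.sum_range_reflect _ m, mul_add]
  unfold oddSum
  have e1 : ∑ j ∈ Finset.range m, 1 / (4 * ((m - 1 - j : ℕ) : ZMod p) + 3) ^ 2 =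
      4⁻¹ * ∑ j ∈ Finset.range m, 1 / (2 * j + 1 : ZMod p) ^ 2 := by
    rw [Finset.mul_sum]
    refine Finset.sum_congr rfl fun j hj => ?_
    have hj := Finset.mem_range.1 hj
    have c1 : ((m - 1 - j : ℕ) : ZMod p) = m - 1 - j := by
      rw [Nat.sub_sub, Nat.cast_sub (by omega)]; push_cast; ring
    have c2 : (4 * (m - 1 - j) + 3 : ZMod p) = -(2 * (2 * j + 1)) := by linear_combination hm
    rw [c1, c2, neg_sq, mul_pow, one_div, one_div, mul_inv]
    norm_num
  have e2 : ∑ j ∈ Finset.range m, 1 / (4 * ((m + j : ℕ) : ZMod p) + 3) ^ 2 =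
      4⁻¹ * ∑ j ∈ Finset.range m, 1 / (2 * j + 1 : ZMod p) ^ 2 := by
    rw [Finset.mul_sum]
    refine Finset.sum_congr rfl fun j hj => ?_
    have c2 : (4 * ((m + j : ℕ) : ZMod p) + 3 : ZMod p) = 2 * (2 * j + 1) := by
      push_cast; linear_combination hm
    rw [c2, mul_pow, one_div, one_div, mul_inv]
    norm_num
  rw [e1, e2]
  field_simp
  ring

end Euler

/-! ### The value of Γ_p at 1/4 modulo p -/

section Gamma

variable {p : ℕ} [Fact p.Prime]

theorem gammaSeq_add_one {k : ℕ} (hk : k < p) :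
    gammaSeq p (k + 1) = (-1) ^ (k + 1) * (k.factorial : ℤ) := by
  have hpp : p.Prime := Fact.out
  induction k with
  | zero =>
    rw [gammaSeq_succ]
    have : ¬ (0 : ℕ).Coprime p := by rw [Nat.coprime_zero_left]; exact hpp.one_lt.ne'
    simp [gammaSeq, hpp.one_lt.ne']
  | succ k ih =>
    rw [gammaSeq_succ, ih (by omega), if_pos, Nat.factorial_succ]
    · push_cast; ring
    · exact Nat.Coprime.symm ((Nat.Prime.coprime_iff_not_dvd hpp).2
        fun hd => absurd (Nat.le_of_dvd (by omega) hd) (by omega))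

/-- N is congruent to 1/4 modulo p, and Γ_p respects congruences modulo p. -/
theorem reduces_padicGamma_quarter (hp : 3 < p) {N c : ℕ} (h : 4 * N = 1 + p * c) :
    Reduces (padicGamma p (PadicInt.inv 4) : ℚ_[p]) ((gammaSeq p N : ℤ) : ZMod p) := by
  have h4 := four_mul_inv_four p (by omega)
  have hn : ‖(PadicInt.inv 4 : ℤ_[p]) - N‖ ≤ (p : ℝ) ^ (-(1 : ℕ) : ℤ) := by
    rw [PadicInt.norm_le_pow_iff_mem_span_pow, Ideal.mem_span_singleton, pow_one]
    refine ⟨-((c : ℤ_[p]) * PadicInt.inv 4), ?_⟩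
    have hN : (4 * N : ℤ_[p]) = 1 + p * c := by exact_mod_cast h
    linear_combination (N : ℤ_[p]) * h4 - PadicInt.inv 4 * hN
  have := norm_padicGamma_sub_le p (by omega) 1 N one_ne_zero _ hn
  rw [PadicInt.norm_le_pow_iff_mem_span_pow, Ideal.mem_span_singleton] at this
  obtain ⟨z, hz⟩ := this
  refine (Reduces.intCast (gammaSeq p N)).of_padicCongr ⟨z, ?_⟩
  have := congrArg (fun x : ℤ_[p] => (x : ℚ_[p])) hz
  simpa using this

theorem reduces_padicGamma_pow_four_of_three {m : ℕ} (h : p = 2 * (2 * m + 1) + 1) (hp : 3 < p) :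
    Reduces ((padicGamma p (PadicInt.inv 4) : ℚ_[p]) ^ 4) ((m.factorial : ZMod p) ^ 4) := by
  have h1 := (reduces_padicGamma_quarter hp (N := m + 1) (c := 1) (by omega)).pow 4
  rw [gammaSeq_add_one (by omega)] at h1
  convert h1 using 1
  push_cast
  rw [mul_pow, ← pow_mul, mul_comm (m + 1), pow_mul]
  norm_num

/-- Here 1/4 ≡ 3m+1, so Γ_p(1/4) ≡ ±(3m)! ≡ ±1/m!. On the other side c_m^2 = (2m)!^2 / (16^m m!^4),
with (2m)!^2 ≡ -1 and 16^m = 2^{p-1} ≡ 1. -/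
theorem reduces_padicGamma_pow_four_of_one {m : ℕ} (h : p = 2 * (2 * m) + 1) (hp : 3 < p) :
    Reduces ((padicGamma p (PadicInt.inv 4) : ℚ_[p]) ^ 4) (-centralRatio (ZMod p) m ^ 2) := by
  have h1 := (reduces_padicGamma_quarter hp (N := 3 * m + 1) (c := 3) (by omega)).pow 4
  rw [gammaSeq_add_one (by omega)] at h1
  convert h1 using 1
  push_cast
  rw [mul_pow, ← pow_mul, mul_comm (3 * m + 1), pow_mul]
  have f1 := factorial_mul_factorial_zmod (p := p) (a := 3 * m) (b := m) (by omega)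
  have f2 := factorial_mul_factorial_zmod (p := p) (a := 2 * m) (b := 2 * m) (by omega)
  rw [Even.neg_one_pow ⟨m, by ring⟩] at f2
  have h2 : (2 : ZMod p) ≠ 0 := two_zmod_ne_zero (by omega)
  have h3 := prod_odd_mul_factorial (K := ZMod p) m
  have h4 := two_pow_zmod hp
  rw [show p - 1 = m * 4 by omega, pow_mul] at h4
  have h5 := factorial_zmod_ne_zero (p := p) (k := m) (by omega)
  have h6 : ((-1 : ZMod p) ^ m) ^ 4 = 1 := by rw [← pow_mul, mul_comm, pow_mul]; norm_num
  have f1' : ((3 * m).factorial * m.factorial : ZMod p) ^ 4 = 1 := by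
    have := congrArg (· ^ 4) f1
    rw [mul_pow, h6, mul_one] at this
    rw [this]; norm_num
  rw [← h3] at f2
  unfold centralRatio
  rw [Finset.prod_div_distrib, prod_even]
  have ht : (2 : ZMod p) ^ m ≠ 0 := pow_ne_zero _ h2
  generalize (∏ j ∈ Finset.range m, (2 * j + 1 : ZMod p)) = P at *
  generalize (2 : ZMod p) ^ m = t at *
  generalize (m.factorial : ZMod p) = f at *
  generalize ((3 * m).factorial : ZMod p) = g at *
  field_simp
  apply mul_left_cancel₀ (pow_ne_zero 4 h5)
  linear_combination f ^ 4 * P ^ 2 * h4 - f ^ 2 * t ^ 2 * f2 - f ^ 2 * t ^ 2 * f1'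

end Gamma

/-! ### Cutting the sum at (p-1)/2 -/

section Truncation

theorem centralRatio_eq_choose (k : ℕ) :
    centralRatio ℚ k = ((2 * k).choose k : ℚ) / 4 ^ k := by
  rw [← Nat.centralBinom_eq_two_mul_choose]
  induction k with
  | zero => simp [centralRatio]
  | succ k ih =>
    have h := Nat.succ_mul_centralBinom_succ k
    have h' : (k + 1 : ℚ) * (k + 1).centralBinom = 2 * (2 * k + 1) * k.centralBinom := by
      exact_mod_cast h
    unfold centralRatio at *
    rw [Finset.prod_range_succ, ih, pow_succ]
    have : (k + 1 : ℚ) ≠ 0 := Nat.cast_add_one_ne_zero k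
    field_simp
    linear_combination -2 * h'

theorem oddHarmonic_eq_oddSum (r k : ℕ) : oddHarmonic r k = oddSum ℚ r k := by
  unfold oddHarmonic oddSum
  induction k with
  | zero => simp
  | succ k ih =>
    rw [Finset.sum_Icc_succ_top (by omega), ih, Finset.sum_range_succ]
    congr 3
    push_cast; ring

theorem truncatedSum_eq (p r : ℕ) (hp : 0 < p) :
    truncatedSum p r = ∑ k ∈ Finset.range p, centralRatio ℚ k ^ 3 * oddSum ℚ r k := by
  obtain ⟨q, rfl⟩ : ∃ q, p = q + 1 := ⟨p - 1, by omega⟩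
  unfold truncatedSum
  rw [Finset.sum_range_succ', Nat.add_sub_cancel]
  have h0 : oddSum ℚ r 0 = 0 := by simp [oddSum]
  rw [h0, mul_zero, add_zero, Finset.range_eq_Ico, Finset.sum_Ico_add'
    (fun k => centralRatio ℚ k ^ 3 * oddSum ℚ r k) 0 q 1, zero_add]
  refine Finset.sum_congr (by ext; simp) fun k _ => ?_
  rw [oddHarmonic_eq_oddSum, centralRatio_eq_choose, div_pow, ← pow_mul, mul_comm k, pow_mul]
  norm_num
  ring

theorem cast_centralRatio {K : Type*} [Field K] [CharZero K] (k : ℕ) :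
    ((centralRatio ℚ k : ℚ) : K) = centralRatio K k := by
  unfold centralRatio; push_cast; rfl

theorem cast_oddSum {K : Type*} [Field K] [CharZero K] (r k : ℕ) :
    ((oddSum ℚ r k : ℚ) : K) = oddSum K r k := by
  unfold oddSum; push_cast; rfl

variable {p n : ℕ} [Fact p.Prime]

theorem natCast_zmod_ne_zero_of_lt_two_mul {k : ℕ} (h0 : 0 < k) (h : k < 2 * p) (hk : k ≠ p) :
    (k : ZMod p) ≠ 0 := by
  rw [Ne, ZMod.natCast_eq_zero_iff]
  rintro ⟨c, rfl⟩
  have hpos : 0 < p := (Fact.out : p.Prime).pos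
  have hc : c < 2 := by
    rw [mul_comm 2] at h; exact lt_of_mul_lt_mul_left h hpos.le
  interval_cases c <;> omega

/-- Reduces a congruence modulo p^m to an exact identity with explicit cofactor w; the residue z
only certifies that w is integral. -/
theorem PadicCongr.of_sub_eq {m : ℕ} {x y w : ℚ_[p]} {z : ZMod p} (hw : Reduces w z)
    (h : x - y = (p : ℚ_[p]) ^ m * w) : PadicCongr p m x y := by
  obtain ⟨u, rfl, -⟩ := hw
  exact ⟨u, h⟩

/-- The factor 2n+1 = p enters c_k as c_k = p u and O_k^{(r)} as p^{-r} + v, with u, v integral. So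
the term is p^{3-r} u^3 (1 + p^r v). -/
theorem padicCongr_tail (h : p = 2 * n + 1) {r : ℕ} (hr : r ≤ 3) {i : ℕ} (hi : i < n) :
    PadicCongr p (3 - r) (centralRatio ℚ_[p] (n + 1 + i) ^ 3 * oddSum ℚ_[p] r (n + 1 + i)) 0 := by
  have hp0 : (p : ℚ_[p]) ≠ 0 := by exact_mod_cast (Fact.out : p.Prime).ne_zero
  have hq : (2 * n + 1 : ℚ_[p]) = p := by exact_mod_cast h.symm
  have hfac : ∀ j < p - 1, Reduces (2 * j + 2 : ℚ_[p]) (2 * j + 2 : ZMod p) ∧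
      (2 * j + 2 : ZMod p) ≠ 0 := fun j hj =>
    ⟨((Reduces.ofNat 2).mul (Reduces.natCast j)).add (Reduces.ofNat 2), by
      exact_mod_cast natCast_zmod_ne_zero_of_lt_two_mul (p := p) (k := 2 * j + 2) (by omega)
        (by omega) (by omega)⟩
  have hodd : ∀ j : ℕ, Reduces (2 * j + 1 : ℚ_[p]) (2 * j + 1 : ZMod p) := fun j =>
    ((Reduces.ofNat 2).mul (Reduces.natCast j)).add Reduces.one
  obtain ⟨u, a, hu, hua⟩ : ∃ (u : ℚ_[p]) (a : ZMod p),
      Reduces u a ∧ centralRatio ℚ_[p] (n + 1 + i) = p * u := by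
    refine ⟨_, _, ((reduces_centralRatio h le_rfl).mul ((hfac n (by omega)).1.inv
      (hfac n (by omega)).2)).mul (Reduces.prod (Finset.range i)
      (fun j => (2 * ((n + 1 + j : ℕ) : ℚ_[p]) + 1) / (2 * ((n + 1 + j : ℕ) : ℚ_[p]) + 2)) _ fun j hj =>
        (hodd _).div (hfac _ (by have := Finset.mem_range.1 hj; omega)).1
          (hfac _ (by have := Finset.mem_range.1 hj; omega)).2), ?_⟩
    unfold centralRatio
    rw [Finset.prod_range_add, Finset.prod_range_succ, hq]
    ring
  obtain ⟨v, b, hv, hvb⟩ : ∃ (v : ℚ_[p]) (b : ZMod p),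
      Reduces v b ∧ oddSum ℚ_[p] r (n + 1 + i) = 1 / (p : ℚ_[p]) ^ r + v := by
    refine ⟨_, _, (reduces_oddSum h r le_rfl).add (Reduces.sum (Finset.range i)
      (fun j => 1 / (2 * ((n + 1 + j : ℕ) : ℚ_[p]) + 1) ^ r) _ fun j hj =>
        Reduces.one.div ((hodd _).pow r) (pow_ne_zero _ ?_)), ?_⟩
    · have := Finset.mem_range.1 hj
      exact_mod_cast natCast_zmod_ne_zero_of_lt_two_mul (p := p) (k := 2 * (n + 1 + j) + 1) (by omega)
        (by omega) (by omega)
    · unfold oddSum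
      rw [Finset.sum_range_add, Finset.sum_range_succ, hq]
      ring
  refine PadicCongr.of_sub_eq ((hu.pow 3).mul (Reduces.one.add ((Reduces.prime.pow r).mul hv))) ?_
  rw [hua, hvb]
  have e : (p : ℚ_[p]) ^ 3 = p ^ (3 - r) * p ^ r := by rw [← pow_add]; congr 1; omega
  rw [sub_zero, mul_pow, e]
  field_simp

theorem padicCongr_truncatedSum (h : p = 2 * n + 1) {r : ℕ} (hr : r ≤ 3) :
    PadicCongr p (3 - r) (truncatedSum p r : ℚ_[p])
      (∑ k ∈ Finset.range (n + 1), centralRatio ℚ_[p] k ^ 3 * oddSum ℚ_[p] r k) := by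
  rw [truncatedSum_eq p r (Fact.out : p.Prime).pos]
  push_cast
  simp only [cast_centralRatio, cast_oddSum]
  have e : Finset.range p = Finset.range ((n + 1) + n) := by congr 1; omega
  rw [e, Finset.sum_range_add]
  have := (PadicCongr.refl (p := p) (3 - r) (∑ k ∈ Finset.range (n + 1),
    centralRatio ℚ_[p] k ^ 3 * oddSum ℚ_[p] r k)).add (PadicCongr.sum (Finset.range n) _ (fun _ => 0)
    fun i hi => padicCongr_tail h hr (Finset.mem_range.1 hi))
  simpa using this

end Truncation

/-! ### Dixon's terms and their logarithmic derivatives modulo p^2 -/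

section Dixon

variable {p n : ℕ} [Fact p.Prime]

/-- With s = 1/2 + j and t = j + 1, the j-th factor is s(s^2 - p^2/4) / (t(t^2 - p^2/4)), even in p,
against (s/t)^3. -/
theorem padicCongr_dixonTerm (h : p = 2 * n + 1) (hp : 3 < p) {k : ℕ} (hk : k ≤ n) :
    PadicCongr p 2 (dixonTerm (1 / 2) (1 / 2 + (p : ℚ_[p]) / 2) n k) (centralRatio ℚ_[p] k ^ 3) := by
  unfold dixonTerm poch centralRatio
  rw [← Finset.prod_mul_distrib, ← Finset.prod_mul_distrib, ← Finset.prod_mul_distrib,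
    ← Finset.prod_mul_distrib, ← Finset.prod_div_distrib, ← Finset.prod_pow]
  have h2 : (2 : ZMod p) ≠ 0 := two_zmod_ne_zero (by omega)
  have hn : (n : ℚ_[p]) = p / 2 - 1 / 2 := by
    have : (p : ℚ_[p]) = 2 * n + 1 := by exact_mod_cast h
    rw [this]; ring
  refine PadicCongr.prod _ _ _ (fun j hj => ?_) fun j hj => ?_
  · have hj := Finset.mem_range.1 hj
    have n1 : (j + 1 : ZMod p) ≠ 0 := add_one_zmod_ne_zero (by omega)
    have n2 : ((j + 1 : ZMod p) ^ 2 - (0 / 2) ^ 2) ≠ 0 := by simpa using n1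
    have rt : Reduces (j + 1 : ℚ_[p]) (j + 1 : ZMod p) := (Reduces.natCast j).add Reduces.one
    have rs : Reduces (1 / 2 + j : ℚ_[p]) (1 / 2 + j : ZMod p) :=
      (Reduces.one.div (Reduces.ofNat 2) h2).add (Reduces.natCast j)
    have rq : Reduces ((p : ℚ_[p]) / 2) (0 / 2) := Reduces.prime.div (Reduces.ofNat 2) h2
    refine PadicCongr.of_sub_eq (((rs.mul ((rs.pow 2).sub (rt.pow 2))).div
      ((rt.pow 3).mul ((rt.pow 2).sub (rq.pow 2))) (mul_ne_zero (pow_ne_zero _ n1) n2)).div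
      ((Reduces.ofNat 2).pow 2) (pow_ne_zero 2 h2)) ?_
    have c1 : (j + 1 : ℚ_[p]) ≠ 0 := Nat.cast_add_one_ne_zero j
    have c2 : (j + 1 - p / 2 : ℚ_[p]) ≠ 0 := by
      intro h0
      have : ((2 * j + 1 - 2 * n : ℤ) : ℚ_[p]) ≠ 0 := by
        exact_mod_cast (by omega : (2 * j + 1 - 2 * n : ℤ) ≠ 0)
      apply this; push_cast; linear_combination 2 * h0 - 2 * hn
    have c3 : (j + 1 + p / 2 : ℚ_[p]) ≠ 0 := by
      intro h0
      have : ((2 * j + 3 + 2 * n : ℕ) : ℚ_[p]) ≠ 0 := by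
        exact_mod_cast (by omega : (2 * j + 3 + 2 * n) ≠ 0)
      apply this; push_cast; linear_combination 2 * h0 + 2 * hn
    have e1 : (1 + j : ℚ_[p]) * (1 + 1 / 2 - (1 / 2 + p / 2) + j) * (1 + 1 / 2 + n + j) =
        (j + 1) * ((j + 1 - p / 2) * (j + 1 + p / 2)) := by rw [hn]; ring
    have e2 : (1 / 2 + j : ℚ_[p]) * (1 / 2 + p / 2 + j) * (-n + j) =
        (1 / 2 + j) * ((1 / 2 + j) ^ 2 - (p / 2) ^ 2) := by rw [hn]; ring
    have e3 : (j + 1 : ℚ_[p]) ^ 2 - (p / 2) ^ 2 = (j + 1 - p / 2) * (j + 1 + p / 2) := by ring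
    have e4 : (2 * j + 1 : ℚ_[p]) / (2 * j + 2) = (1 / 2 + j) / (j + 1) := by
      rw [show (2 * j + 2 : ℚ_[p]) = 2 * (j + 1) by ring]; field_simp; ring
    rw [e1, e2, e3, e4]
    generalize (1 / 2 + j : ℚ_[p]) = s at *
    generalize (j + 1 : ℚ_[p]) = t at *
    have e5 : (s ^ 2 - (p / 2) ^ 2 : ℚ_[p]) = s ^ 2 - t ^ 2 + (t - p / 2) * (t + p / 2) := by ring
    rw [e5]
    have e6 : (p : ℚ_[p]) ^ 2 = 2 ^ 2 * (t ^ 2 - (t - p / 2) * (t + p / 2)) := by ring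
    rw [e6]
    generalize (t - p / 2 : ℚ_[p]) = t1 at *
    generalize (t + p / 2 : ℚ_[p]) = t2 at *
    field_simp
    ring
  · have hj := Finset.mem_range.1 hj
    have n2 : (2 * j + 2 : ZMod p) ≠ 0 := by
      exact_mod_cast natCast_zmod_ne_zero (p := p) (k := 2 * j + 2) (by omega) (by omega)
    exact (((((Reduces.ofNat 2).mul (Reduces.natCast j)).add Reduces.one).div
      (((Reduces.ofNat 2).mul (Reduces.natCast j)).add (Reduces.ofNat 2)) n2).pow 3).integral

theorem padicCongr_logDeriv_dixonTerm (h : p = 2 * n + 1) (hp : 3 < p) {k : ℕ} (hk : k ≤ n) :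
    PadicCongr p 2 (∑ j ∈ Finset.range k, 1 / (1 / 2 + j : ℚ_[p]) +
        ∑ j ∈ Finset.range k, 2 / (1 / 2 + (p : ℚ_[p]) / 2 + j)
        - (∑ j ∈ Finset.range k, -1 / (1 - (p : ℚ_[p]) / 2 + j) +
          ∑ j ∈ Finset.range k, 1 / (3 / 2 + n + j : ℚ_[p])))
      (6 * oddSum ℚ_[p] 1 k - 4 * p * oddSum ℚ_[p] 2 k + p * harmonicTwo ℚ_[p] k) := by
  unfold oddSum harmonicTwo
  rw [Finset.mul_sum, Finset.mul_sum, Finset.mul_sum, ← Finset.sum_add_distrib,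
    ← Finset.sum_add_distrib, ← Finset.sum_sub_distrib, ← Finset.sum_sub_distrib,
    ← Finset.sum_add_distrib]
  have h2 : (2 : ZMod p) ≠ 0 := two_zmod_ne_zero (by omega)
  have h4 : (4 : ZMod p) ≠ 0 := by
    rw [show (4 : ZMod p) = 2 ^ 2 by norm_num]; exact pow_ne_zero _ h2
  have hn : (n : ℚ_[p]) = p / 2 - 1 / 2 := by
    have : (p : ℚ_[p]) = 2 * n + 1 := by exact_mod_cast h
    rw [this]; ring
  refine PadicCongr.sum _ _ _ fun j hj => ?_
  have hj := Finset.mem_range.1 hj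
  have n1 : (j + 1 : ZMod p) ≠ 0 := add_one_zmod_ne_zero (by omega)
  have n2 : ((j + 1 : ZMod p) ^ 2 - (0 / 2) ^ 2) ≠ 0 := by simpa using n1
  have n3 : (1 / 2 + j : ZMod p) ≠ 0 := by
    intro h0
    apply odd_zmod_ne_zero h (j := j) (by omega)
    field_simp at h0
    linear_combination h0
  have n4 : (1 / 2 + j + 0 / 2 : ZMod p) ≠ 0 := by simpa using n3
  have rt : Reduces (j + 1 : ℚ_[p]) (j + 1 : ZMod p) := (Reduces.natCast j).add Reduces.one
  have rs : Reduces (1 / 2 + j : ℚ_[p]) (1 / 2 + j : ZMod p) :=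
    (Reduces.one.div (Reduces.ofNat 2) h2).add (Reduces.natCast j)
  have rq : Reduces ((p : ℚ_[p]) / 2) (0 / 2) := Reduces.prime.div (Reduces.ofNat 2) h2
  refine PadicCongr.of_sub_eq ((Reduces.one.div (((Reduces.ofNat 2).mul (rs.pow 2)).mul
    (rs.add rq)) (mul_ne_zero (mul_ne_zero h2 (pow_ne_zero 2 n3)) n4)).add (Reduces.prime.div
    (((Reduces.ofNat 4).mul (rt.pow 2)).mul ((rt.pow 2).sub (rq.pow 2)))
    (mul_ne_zero (mul_ne_zero h4 (pow_ne_zero 2 n1)) n2))) ?_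
  have c1 : (j + 1 : ℚ_[p]) ≠ 0 := Nat.cast_add_one_ne_zero j
  have c2 : (j + 1 - p / 2 : ℚ_[p]) ≠ 0 := by
    intro h0
    have : ((2 * j + 1 - 2 * n : ℤ) : ℚ_[p]) ≠ 0 := by
      exact_mod_cast (by omega : (2 * j + 1 - 2 * n : ℤ) ≠ 0)
    apply this; push_cast; linear_combination 2 * h0 - 2 * hn
  have c3 : (j + 1 + p / 2 : ℚ_[p]) ≠ 0 := by
    intro h0
    have : ((2 * j + 3 + 2 * n : ℕ) : ℚ_[p]) ≠ 0 := by
      exact_mod_cast (by omega : (2 * j + 3 + 2 * n) ≠ 0)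
    apply this; push_cast; linear_combination 2 * h0 + 2 * hn
  have c4 : (1 / 2 + j : ℚ_[p]) ≠ 0 := half_add_ne_zero j
  have c5 : (1 / 2 + j + p / 2 : ℚ_[p]) ≠ 0 := by
    intro h0
    have : ((j + 1 + n : ℕ) : ℚ_[p]) ≠ 0 := by
      exact_mod_cast (by omega : (j + 1 + n) ≠ 0)
    apply this; push_cast; linear_combination h0 + hn
  have e1 : (1 / 2 + p / 2 + j : ℚ_[p]) = 1 / 2 + j + p / 2 := by ring
  have e2 : (1 - p / 2 + j : ℚ_[p]) = j + 1 - p / 2 := by ring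
  have e3 : (3 / 2 + n + j : ℚ_[p]) = j + 1 + p / 2 := by rw [hn]; ring
  have e4 : (2 * j + 1 : ℚ_[p]) = 2 * (1 / 2 + j) := by ring
  have e5 : (j + 1 : ℚ_[p]) ^ 2 - (p / 2) ^ 2 = (j + 1 - p / 2) * (j + 1 + p / 2) := by ring
  rw [e1, e2, e3, e4, e5]
  generalize (1 / 2 + j : ℚ_[p]) = s at *
  generalize (j + 1 : ℚ_[p]) = t at *
  -- First-order expansions in p with exact remainders: `i1` yields the O^{(2)} correction, `i2` the
  -- H^{(2)} one.
  have i1 : 2 / (s + p / 2) - 2 / s + p / s ^ 2 = (p : ℚ_[p]) ^ 2 * (1 / (2 * s ^ 2 * (s + p / 2))) := by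
    rw [eq_comm, ← sub_eq_zero]
    have : (s + p / 2 : ℚ_[p]) = (2 * s + p) / 2 := by ring
    rw [this] at c5 ⊢
    have c5' : (2 * s + p : ℚ_[p]) ≠ 0 := fun h0 => c5 (by rw [h0]; simp)
    field_simp
    ring
  have i2 : 1 / (t - p / 2) - 1 / (t + p / 2) - p / t ^ 2 =
      (p : ℚ_[p]) ^ 2 * (p / (4 * t ^ 2 * ((t - p / 2) * (t + p / 2)))) := by
    have d1 : (t - p / 2 : ℚ_[p]) = (2 * t - p) / 2 := by ring
    have d2 : (t + p / 2 : ℚ_[p]) = (2 * t + p) / 2 := by ring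
    rw [d1] at c2 ⊢
    rw [d2] at c3 ⊢
    have c2' : (2 * t - p : ℚ_[p]) ≠ 0 := fun h0 => c2 (by rw [h0]; simp)
    have c3' : (2 * t + p : ℚ_[p]) ≠ 0 := fun h0 => c3 (by rw [h0]; simp)
    field_simp
    ring
  rw [mul_add, ← i1, ← i2]
  field_simp
  ring

end Dixon

/-! ### Dixon's closed form and its p-adic behaviour -/

section ClosedForms

/-- Reversing j ↦ n-1-j turns the q-dependent denominators into multiples of 4j+3 and 2j+1. The odd
reciprocals telescope to 2/q - 2, and the -2 becomes the j = 0 term of the last sum. -/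
theorem sum_logDeriv_closedForm {K : Type*} [Field K] [CharZero K] (n : ℕ) (q : K)
    (hq : q = 2 * n + 1) :
    ∑ j ∈ Finset.range n, (1 / (3 / 2 + j : K) + -(3 / 2) / (3 / 4 - q / 2 + j) -
        (1 / 2 / (5 / 4 + j : K) + -1 / (1 - q / 2 + j))) =
      2 / q + 6 * ∑ j ∈ Finset.range n, 1 / (4 * j + 3 : K) -
        2 * ∑ j ∈ Finset.range (n + 1), 1 / (4 * j + 1 : K) := by
  have hr : ∀ j ∈ Finset.range n, ((n - 1 - j : ℕ) : K) = n - 1 - j := fun j hj => by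
    have := Finset.mem_range.1 hj
    rw [Nat.sub_sub, Nat.cast_sub (by omega)]; push_cast; ring
  have c1 : ∀ j : ℕ, (2 * j + 1 : K) ≠ 0 := fun j => by exact_mod_cast (by omega : 2 * j + 1 ≠ 0)
  have c3 : ∀ j : ℕ, (4 * j + 3 : K) ≠ 0 := fun j => by exact_mod_cast (by omega : 4 * j + 3 ≠ 0)
  have c5 : ∀ j : ℕ, (4 * j + 5 : K) ≠ 0 := fun j => by exact_mod_cast (by omega : 4 * j + 5 ≠ 0)
  have e2 : ∑ j ∈ Finset.range n, -(3 / 2) / (3 / 4 - q / 2 + j) =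
      6 * ∑ j ∈ Finset.range n, 1 / (4 * j + 3 : K) := by
    rw [← Finset.sum_range_reflect, Finset.mul_sum]
    refine Finset.sum_congr rfl fun j hj => ?_
    rw [hr j hj, hq, show (3 / 4 - (2 * n + 1) / 2 + (n - 1 - j) : K) = -(4 * j + 3) / 4 by ring]
    have := c3 j
    field_simp
    ring
  have e4 : ∑ j ∈ Finset.range n, -1 / (1 - q / 2 + j) =
      ∑ j ∈ Finset.range n, 2 / (2 * j + 1 : K) := by
    rw [← Finset.sum_range_reflect]
    refine Finset.sum_congr rfl fun j hj => ?_
    rw [hr j hj, hq, show (1 - (2 * n + 1) / 2 + (n - 1 - j) : K) = -(2 * j + 1) / 2 by ring]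
    have := c1 j
    field_simp
  have e1 : ∑ j ∈ Finset.range n, 1 / (3 / 2 + j : K) =
      ∑ j ∈ Finset.range n, 2 / (2 * ((j + 1 : ℕ) : K) + 1) := by
    refine Finset.sum_congr rfl fun j _ => ?_
    have h1 := c1 (j + 1)
    rw [show (3 / 2 + j : K) = (2 * ((j + 1 : ℕ) : K) + 1) / 2 by push_cast; ring]
    field_simp
  have e3 : ∑ j ∈ Finset.range n, 1 / 2 / (5 / 4 + j : K) =
      2 * ∑ j ∈ Finset.range n, 1 / (4 * ((j + 1 : ℕ) : K) + 1) := by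
    rw [Finset.mul_sum]
    refine Finset.sum_congr rfl fun j _ => ?_
    have h1 := c5 j
    rw [show (5 / 4 + j : K) = (4 * j + 5) / 4 by ring,
      show (4 * ((j + 1 : ℕ) : K) + 1) = 4 * j + 5 by push_cast; ring]
    field_simp
    norm_num
  have h5 := Finset.sum_range_succ' (fun j : ℕ => 2 / (2 * (j : K) + 1)) n
  rw [Finset.sum_range_succ] at h5
  rw [Finset.sum_sub_distrib, Finset.sum_add_distrib, Finset.sum_add_distrib, e1, e2, e3, e4,
    Finset.sum_range_succ' (fun j : ℕ => 1 / (4 * (j : K) + 1)), hq]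
  simp only [Nat.cast_zero, mul_zero, zero_add, div_one] at h5 ⊢
  linear_combination -h5

/-- After the same reversal the factors (2j+3)/(2j+1) telescope to q. -/
theorem sum_dixonTerm_closedForm {K : Type*} [Field K] [CharZero K] (n : ℕ) (q : K)
    (hq : q = 2 * n + 1) :
    ∑ k ∈ Finset.range (n + 1), dixonTerm (1 / 2) (1 / 2 + q / 2) n k =
      q * ∏ j ∈ Finset.range n, ((4 * j + 3 : K) / (4 * j + 5)) := by
  have hr : ∀ j ∈ Finset.range n, ((n - 1 - j : ℕ) : K) = n - 1 - j := fun j hj => by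
    have := Finset.mem_range.1 hj
    rw [Nat.sub_sub, Nat.cast_sub (by omega)]; push_cast; ring
  have c1 : ∀ j : ℕ, (2 * j + 1 : K) ≠ 0 := fun j => by exact_mod_cast (by omega : 2 * j + 1 ≠ 0)
  have c3 : ∀ j : ℕ, (2 * j + 3 : K) ≠ 0 := fun j => by exact_mod_cast (by omega : 2 * j + 3 ≠ 0)
  have c5 : ∀ j : ℕ, (4 * j + 5 : K) ≠ 0 := fun j => by exact_mod_cast (by omega : 4 * j + 5 ≠ 0)
  rw [sum_dixonTerm]
  · have e1 : ∏ j ∈ Finset.range n, (1 + 1 / 2 / 2 - (1 / 2 + q / 2) + j : K) =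
        ∏ j ∈ Finset.range n, -((4 * j + 3 : K) / 4) := by
      rw [← Finset.prod_range_reflect]
      refine Finset.prod_congr rfl fun j hj => ?_
      rw [hr j hj, hq]; ring
    have e2 : ∏ j ∈ Finset.range n, (1 + 1 / 2 - (1 / 2 + q / 2) + j : K) =
        ∏ j ∈ Finset.range n, -((2 * j + 1 : K) / 2) := by
      rw [← Finset.prod_range_reflect]
      refine Finset.prod_congr rfl fun j hj => ?_
      rw [hr j hj, hq]; ring
    rw [Finset.prod_div_distrib, Finset.prod_mul_distrib, Finset.prod_mul_distrib, e1, e2,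
      ← Finset.prod_mul_distrib, ← Finset.prod_mul_distrib, ← Finset.prod_div_distrib]
    have e3 : ∀ N : ℕ, ∏ j ∈ Finset.range N, ((1 + 1 / 2 + j : K) * -((4 * j + 3) / 4) /
        ((1 + 1 / 2 / 2 + j : K) * -((2 * j + 1) / 2))) =
        (2 * N + 1) * ∏ j ∈ Finset.range N, ((4 * j + 3 : K) / (4 * j + 5)) := by
      intro N
      induction N with
      | zero => simp
      | succ N ih =>
        rw [Finset.prod_range_succ, ih, Finset.prod_range_succ]
        have := c1 N
        have := c5 N
        rw [show (1 + 1 / 2 / 2 + N : K) = (4 * N + 5) / 4 by ring]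
        push_cast
        field_simp
        ring
    rw [e3, hq]
  · intro j _ h0
    have : ((2 * j + 1 - 2 * n : ℤ) : K) ≠ 0 := by
      exact_mod_cast (by omega : (2 * j + 1 - 2 * n : ℤ) ≠ 0)
    apply this; push_cast; linear_combination 2 * h0 + hq
  · intro j _ h0
    apply c3 j; linear_combination 2 * h0
  · intro j _ h0
    apply c5 j; linear_combination 4 * h0

variable {p n : ℕ} [Fact p.Prime]

theorem Reduces.congr {x : ℚ_[p]} {y y' : ZMod p} (h : Reduces x y) (e : y' = y) :
    Reduces x y' := e ▸ h

theorem reduces_four_mul_add (j c : ℕ) :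
    Reduces (4 * j + c : ℚ_[p]) (4 * j + c : ZMod p) :=
  ((Reduces.ofNat 4).mul (Reduces.natCast j)).add (Reduces.natCast c)

/-- The congruence modulo `p ^ 2` obtained by differentiating Dixon's summation. -/
theorem padicCongr_six_mul_sum (h : p = 2 * n + 1) (hp : 3 < p) :
    PadicCongr p 2
      ((∑ k ∈ Finset.range (n + 1), dixonTerm (1 / 2) (1 / 2 + (p : ℚ_[p]) / 2) n k) *
        (2 / p + 6 * ∑ j ∈ Finset.range n, 1 / (4 * j + 3 : ℚ_[p]) -
          2 * ∑ j ∈ Finset.range (n + 1), 1 / (4 * j + 1 : ℚ_[p])))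
      (6 * ∑ k ∈ Finset.range (n + 1), centralRatio ℚ_[p] k ^ 3 * oddSum ℚ_[p] 1 k -
        p * (4 * ∑ k ∈ Finset.range (n + 1), centralRatio ℚ_[p] k ^ 3 * oddSum ℚ_[p] 2 k -
          ∑ k ∈ Finset.range (n + 1), centralRatio ℚ_[p] k ^ 3 * harmonicTwo ℚ_[p] k)) := by
  have hq : (p : ℚ_[p]) = 2 * n + 1 := by exact_mod_cast h
  rw [← sum_logDeriv_closedForm n (p : ℚ_[p]) hq, ← sum_dixonTerm_mul_logDeriv n (p : ℚ_[p]) hq]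
  have e : (6 * ∑ k ∈ Finset.range (n + 1), centralRatio ℚ_[p] k ^ 3 * oddSum ℚ_[p] 1 k -
        p * (4 * ∑ k ∈ Finset.range (n + 1), centralRatio ℚ_[p] k ^ 3 * oddSum ℚ_[p] 2 k -
          ∑ k ∈ Finset.range (n + 1), centralRatio ℚ_[p] k ^ 3 * harmonicTwo ℚ_[p] k)) =
      ∑ k ∈ Finset.range (n + 1), centralRatio ℚ_[p] k ^ 3 *
        (6 * oddSum ℚ_[p] 1 k - 4 * p * oddSum ℚ_[p] 2 k + p * harmonicTwo ℚ_[p] k) := by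
    simp only [Finset.mul_sum, ← Finset.sum_sub_distrib]
    refine Finset.sum_congr rfl fun k _ => by ring
  rw [e]
  refine PadicCongr.sum _ _ _ fun k hk => ?_
  have hk : k ≤ n := by have := Finset.mem_range.1 hk; omega
  have hw := padicCongr_dixonTerm h hp hk
  have hc := ((reduces_centralRatio h hk).pow 3).integral
  refine hw.mul (padicCongr_logDeriv_dixonTerm h hp hk) (hw.integral_of hc) ?_
  exact ((((Reduces.ofNat 6).mul (reduces_oddSum h 1 hk)).sub (((Reduces.ofNat 4).mul
    Reduces.prime).mul (reduces_oddSum h 2 hk))).add (Reduces.prime.mul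
    (reduces_harmonicTwo (by omega)))).integral

theorem reduces_sum_mul_oddSum (h : p = 2 * n + 1) (r : ℕ) :
    Reduces (∑ k ∈ Finset.range (n + 1), centralRatio ℚ_[p] k ^ 3 * oddSum ℚ_[p] r k)
      (∑ k ∈ Finset.range (n + 1), centralRatio (ZMod p) k ^ 3 * oddSum (ZMod p) r k) :=
  Reduces.sum _ _ _ fun k hk => by
    have hk : k ≤ n := by have := Finset.mem_range.1 hk; omega
    exact ((reduces_centralRatio h hk).pow 3).mul (reduces_oddSum h r hk)

theorem reduces_sum_mul_harmonicTwo (h : p = 2 * n + 1) :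
    Reduces (∑ k ∈ Finset.range (n + 1), centralRatio ℚ_[p] k ^ 3 * harmonicTwo ℚ_[p] k)
      (∑ k ∈ Finset.range (n + 1), centralRatio (ZMod p) k ^ 3 * harmonicTwo (ZMod p) k) :=
  Reduces.sum _ _ _ fun k hk => by
    have hk : k ≤ n := by have := Finset.mem_range.1 hk; omega
    exact ((reduces_centralRatio h hk).pow 3).mul (reduces_harmonicTwo (by omega))

theorem reduces_sum_dixonTerm (h : p = 2 * n + 1) (hp : 3 < p) :
    Reduces (∑ k ∈ Finset.range (n + 1), dixonTerm (1 / 2) (1 / 2 + (p : ℚ_[p]) / 2) n k)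
      (∑ k ∈ Finset.range (n + 1), centralRatio (ZMod p) k ^ 3) :=
  Reduces.sum _ _ _ fun k hk => by
    have hk : k ≤ n := by have := Finset.mem_range.1 hk; omega
    exact ((reduces_centralRatio h hk).pow 3).of_padicCongr
      ((padicCongr_dixonTerm h hp hk).mono one_le_two)

theorem eight_zmod_ne_zero (hp : 3 < p) : (8 : ZMod p) ≠ 0 := by
  rw [show (8 : ZMod p) = 2 ^ 3 by norm_num]
  exact pow_ne_zero _ (two_zmod_ne_zero (by omega))

/-- The denominators at j and 2m-1-j add up to 2p, so pairing them extracts a factor p. -/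
theorem exists_sum_four_mul_add_three {m : ℕ} (h : p = 2 * (2 * m) + 1) (hp : 3 < p) :
    ∃ y : ℚ_[p], Reduces y (harmonicTwo (ZMod p) m / 8) ∧
      ∑ j ∈ Finset.range (2 * m), 1 / (4 * j + 3 : ℚ_[p]) = p * y := by
  have hq : (p : ℚ_[p]) = 2 * (2 * m) + 1 := by exact_mod_cast h
  have n3 : ∀ j ∈ Finset.range (2 * m), (4 * j + 3 : ZMod p) ≠ 0 := fun j hj => by
    have := Finset.mem_range.1 hj
    exact_mod_cast natCast_zmod_ne_zero_of_lt_two_mul (p := p) (k := 4 * j + 3) (by omega)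
      (by omega) (by omega)
  have r3 : ∀ j : ℕ, Reduces (4 * j + 3 : ℚ_[p]) (4 * j + 3 : ZMod p) := fun j => by
    exact_mod_cast reduces_four_mul_add (p := p) j 3
  have key : Reduces (p := p) (∑ j ∈ Finset.range (2 * m),
      1 / ((4 * j + 3 : ℚ_[p]) * (2 * p - (4 * j + 3)))) _ :=
    Reduces.sum _ _ _ fun j hj => Reduces.one.div ((r3 j).mul (((Reduces.ofNat 2).mul
      Reduces.prime).sub (r3 j))) (mul_ne_zero (n3 j hj)
        (by rw [mul_zero, zero_sub]; exact neg_ne_zero.2 (n3 j hj)))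
  refine ⟨_, key.congr ?_, ?_⟩
  rotate_left
  · have hs := Finset.sum_range_reflect (fun j : ℕ => 1 / (4 * (j : ℚ_[p]) + 3)) (2 * m)
    have h2 : (2 : ℚ_[p]) ≠ 0 := two_ne_zero
    apply mul_left_cancel₀ h2
    rw [two_mul]
    nth_rewrite 1 [← hs]
    rw [← Finset.sum_add_distrib]
    have : ∀ j ∈ Finset.range (2 * m), 1 / (4 * ((2 * m - 1 - j : ℕ) : ℚ_[p]) + 3) +
        1 / (4 * (j : ℚ_[p]) + 3) = 2 * p * (1 / ((4 * j + 3 : ℚ_[p]) * (2 * p - (4 * j + 3)))) := by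
      intro j hj
      have hj := Finset.mem_range.1 hj
      have c1 : ((2 * m - 1 - j : ℕ) : ℚ_[p]) = 2 * m - 1 - j := by
        rw [Nat.sub_sub, Nat.cast_sub (by omega)]; push_cast; ring
      have c2 : (4 * ((2 * m - 1 - j : ℕ) : ℚ_[p]) + 3) = 2 * p - (4 * j + 3) := by
        rw [c1, hq]; ring
      have n1 : (4 * ((2 * m - 1 - j : ℕ) : ℚ_[p]) + 3) ≠ 0 := by
        exact_mod_cast (by omega : 4 * (2 * m - 1 - j) + 3 ≠ 0)
      have n2 : (4 * (j : ℚ_[p]) + 3) ≠ 0 := by exact_mod_cast (by omega : 4 * j + 3 ≠ 0)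
      rw [c2] at n1 ⊢
      generalize (4 * (j : ℚ_[p]) + 3) = s at *
      field_simp
      ring
    rw [Finset.sum_congr rfl this, ← Finset.mul_sum, mul_assoc]
  · have h8 := eight_zmod_ne_zero hp
    rw [div_eq_iff h8, ← neg_eq_iff_eq_neg.2 (sum_four_mul_add_three_zmod h hp), mul_comm _ (8 : ZMod p),
      ← mul_neg, ← Finset.sum_neg_distrib]
    congr 1
    refine Finset.sum_congr rfl fun j hj => ?_
    rw [mul_zero, zero_sub, mul_neg, div_neg, sq]

/-- The middle denominator 4m+1 is p itself; the others pair up as p ∓ 4(j+1), each pair being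
divisible by p. -/
theorem exists_sum_four_mul_add_one {m : ℕ} (h : p = 2 * (2 * m) + 1) (hp : 3 < p) :
    ∃ y : ℚ_[p], Reduces y (-harmonicTwo (ZMod p) m / 8) ∧
      ∑ j ∈ Finset.range (2 * m + 1), 1 / (4 * j + 1 : ℚ_[p]) = 1 / p + p * y := by
  have hq : (p : ℚ_[p]) = 2 * (2 * m) + 1 := by exact_mod_cast h
  have h8 := eight_zmod_ne_zero hp
  have h2 : (2 : ZMod p) ≠ 0 := two_zmod_ne_zero (by omega)
  have h4 : (4 : ZMod p) ≠ 0 := by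
    rw [show (4 : ZMod p) = 2 ^ 2 by norm_num]; exact pow_ne_zero _ h2
  have n3 : ∀ j ∈ Finset.range m, (4 * (j + 1) : ZMod p) ≠ 0 := fun j hj => by
    have := Finset.mem_range.1 hj
    exact mul_ne_zero h4 (add_one_zmod_ne_zero (by omega))
  have key : Reduces (p := p) (∑ j ∈ Finset.range m,
      2 / ((p : ℚ_[p]) ^ 2 - (4 * (j + 1)) ^ 2)) _ :=
    Reduces.sum _ _ _ fun j hj => (Reduces.ofNat 2).div ((Reduces.prime.pow 2).sub
      (((Reduces.ofNat 4).mul ((Reduces.natCast j).add Reduces.one)).pow 2))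
      (show (0 : ZMod p) ^ 2 - (4 * (j + 1)) ^ 2 ≠ 0 by simpa using n3 j hj)
  refine ⟨_, key.congr ?_, ?_⟩
  rotate_left
  · rw [show 2 * m + 1 = m + 1 + m by ring, Finset.sum_range_add, Finset.sum_range_succ,
      ← Finset.sum_range_reflect]
    have hm : (4 * m + 1 : ℚ_[p]) = p := by rw [hq]; ring
    rw [hm]
    have : ∀ j ∈ Finset.range m, 1 / (4 * ((m - 1 - j : ℕ) : ℚ_[p]) + 1) +
        1 / (4 * ((m + 1 + j : ℕ) : ℚ_[p]) + 1) = p * (2 / ((p : ℚ_[p]) ^ 2 - (4 * (j + 1)) ^ 2)) := by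
      intro j hj
      have hj := Finset.mem_range.1 hj
      have c1 : ((m - 1 - j : ℕ) : ℚ_[p]) = m - 1 - j := by
        rw [Nat.sub_sub, Nat.cast_sub (by omega)]; push_cast; ring
      have c2 : (4 * ((m - 1 - j : ℕ) : ℚ_[p]) + 1) = p - 4 * (j + 1) := by
        rw [c1, ← hm]; ring
      have c3 : (4 * ((m + 1 + j : ℕ) : ℚ_[p]) + 1) = p + 4 * (j + 1) := by
        rw [← hm]; push_cast; ring
      have n1 : (4 * ((m - 1 - j : ℕ) : ℚ_[p]) + 1) ≠ 0 := by
        exact_mod_cast (by omega : 4 * (m - 1 - j) + 1 ≠ 0)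
      have n2 : (4 * ((m + 1 + j : ℕ) : ℚ_[p]) + 1) ≠ 0 := by
        exact_mod_cast (by omega : 4 * (m + 1 + j) + 1 ≠ 0)
      rw [c2] at n1 ⊢
      rw [c3] at n2 ⊢
      rw [sq_sub_sq]
      field_simp
      ring
    rw [add_right_comm, ← Finset.sum_add_distrib, Finset.sum_congr rfl this, ← Finset.mul_sum,
      add_comm]
  · unfold harmonicTwo
    rw [← Finset.sum_neg_distrib, Finset.sum_div]
    refine Finset.sum_congr rfl fun j hj => ?_
    have hj := Finset.mem_range.1 hj
    have n1 : (j + 1 : ZMod p) ≠ 0 := add_one_zmod_ne_zero (by omega)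
    rw [zero_pow two_ne_zero, zero_sub, mul_pow, show (4 : ZMod p) ^ 2 = 2 * 8 by norm_num]
    field_simp

/-- The only pole in the sums is 4m+3 = p, which adds 6/p to 2/p. The residue of y is immaterial,
because Dixon's value carries p^2. -/
theorem exists_sum_four_mul_add_of_three {m : ℕ} (h : p = 2 * (2 * m + 1) + 1) (hp : 3 < p) :
    ∃ (y : ℚ_[p]) (z : ZMod p), Reduces y z ∧
      2 / p + 6 * ∑ j ∈ Finset.range (2 * m + 1), 1 / (4 * j + 3 : ℚ_[p]) -
          2 * ∑ j ∈ Finset.range (2 * m + 1 + 1), 1 / (4 * j + 1 : ℚ_[p]) = 8 / p + y := by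
  have hq : (p : ℚ_[p]) = 4 * m + 3 := by
    have : p = 4 * m + 3 := by omega
    exact_mod_cast this
  have r3 : ∀ j : ℕ, Reduces (4 * j + 3 : ℚ_[p]) (4 * j + 3 : ZMod p) := fun j => by
    exact_mod_cast reduces_four_mul_add (p := p) j 3
  have r1 : ∀ j : ℕ, Reduces (4 * j + 1 : ℚ_[p]) (4 * j + 1 : ZMod p) := fun j => by
    exact_mod_cast reduces_four_mul_add (p := p) j 1
  have k1 : Reduces (p := p) (∑ j ∈ Finset.range (2 * m + 1 + 1), 1 / (4 * j + 1 : ℚ_[p])) _ :=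
    Reduces.sum _ _ _ fun j hj => Reduces.one.div (r1 j) (by
      have := Finset.mem_range.1 hj
      exact_mod_cast natCast_zmod_ne_zero_of_lt_two_mul (p := p) (k := 4 * j + 1) (by omega)
        (by omega) (by omega))
  have k2 : Reduces (p := p) (∑ j ∈ Finset.range m, 1 / (4 * j + 3 : ℚ_[p])) _ :=
    Reduces.sum _ _ _ fun j hj => Reduces.one.div (r3 j) (by
      have := Finset.mem_range.1 hj
      exact_mod_cast natCast_zmod_ne_zero_of_lt_two_mul (p := p) (k := 4 * j + 3) (by omega)
        (by omega) (by omega))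
  have k3 : Reduces (p := p) (∑ j ∈ Finset.range m, 1 / (4 * ((m + 1 + j : ℕ) : ℚ_[p]) + 3)) _ :=
    Reduces.sum _ _ _ fun j hj => Reduces.one.div (r3 (m + 1 + j)) (by
      have := Finset.mem_range.1 hj
      exact_mod_cast natCast_zmod_ne_zero_of_lt_two_mul (p := p) (k := 4 * (m + 1 + j) + 3) (by omega)
        (by omega) (by omega))
  refine ⟨_, _, ((Reduces.ofNat 6).mul (k2.add k3)).sub ((Reduces.ofNat 2).mul k1), ?_⟩
  have e : Finset.range (2 * m + 1) = Finset.range (m + 1 + m) := by congr 1; omega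
  rw [e, Finset.sum_range_add, Finset.sum_range_succ (fun j : ℕ => 1 / (4 * (j : ℚ_[p]) + 3)), ← hq]
  ring

/-- One p is the leading factor of the closed form, the other is the numerator 4m+3; no denominator
4j+5 is divisible by p. The cofactor is evaluated with 4m ≡ -3, Wilson and Fermat. -/
theorem exists_sum_dixonTerm_of_three {m : ℕ} (h : p = 2 * (2 * m + 1) + 1) (hp : 3 < p) :
    ∃ V : ℚ_[p], Reduces V (-(m.factorial : ZMod p) ^ 4 / 16) ∧
      ∑ k ∈ Finset.range (2 * m + 1 + 1),
        dixonTerm (1 / 2) (1 / 2 + (p : ℚ_[p]) / 2) (2 * m + 1) k = p ^ 2 * V := by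
  have hq : (p : ℚ_[p]) = 4 * m + 3 := by
    have : p = 4 * m + 3 := by omega
    exact_mod_cast this
  have h2 : (2 : ZMod p) ≠ 0 := two_zmod_ne_zero (by omega)
  have h4 : (4 : ZMod p) ≠ 0 := by
    rw [show (4 : ZMod p) = 2 ^ 2 by norm_num]; exact pow_ne_zero _ h2
  have hm : (4 * m + 3 : ZMod p) = 0 := by
    have : ((4 * m + 3 : ℕ) : ZMod p) = 0 := by
      rw [show 4 * m + 3 = p by omega]; exact ZMod.natCast_self p
    exact_mod_cast this
  have hr : ∀ j ∈ Finset.range m, ((m - 1 - j : ℕ) : ZMod p) = m - 1 - j := fun j hj => by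
    have := Finset.mem_range.1 hj
    rw [Nat.sub_sub, Nat.cast_sub (by omega)]; push_cast; ring
  have r3 : ∀ j : ℕ, Reduces (4 * j + 3 : ℚ_[p]) (4 * j + 3 : ZMod p) := fun j => by
    exact_mod_cast reduces_four_mul_add (p := p) j 3
  have r5 : ∀ j : ℕ, Reduces (4 * j + 5 : ℚ_[p]) (4 * j + 5 : ZMod p) := fun j => by
    exact_mod_cast reduces_four_mul_add (p := p) j 5
  have k1 : Reduces (p := p) (∏ j ∈ Finset.range m, (4 * j + 3 : ℚ_[p])) _ :=
    Reduces.prod _ _ _ fun j _ => r3 j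
  have k2 : Reduces (p := p) (∏ j ∈ Finset.range m, (4 * ((m + 1 + j : ℕ) : ℚ_[p]) + 3)) _ :=
    Reduces.prod _ _ _ fun j _ => r3 (m + 1 + j)
  have k3 : Reduces (p := p) (∏ j ∈ Finset.range (m + (m + 1)), (4 * j + 5 : ℚ_[p])) _ :=
    Reduces.prod _ _ _ fun j _ => r5 j
  have n5 : ∏ j ∈ Finset.range (m + (m + 1)), (4 * j + 5 : ZMod p) ≠ 0 :=
    Finset.prod_ne_zero_iff.2 fun j hj => by
      have := Finset.mem_range.1 hj
      exact_mod_cast natCast_zmod_ne_zero_of_lt_two_mul (p := p) (k := 4 * j + 5) (by omega)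
        (by omega) (by omega)
  have hV := (k1.mul k2).div k3 n5
  refine ⟨_, hV.congr ?_, ?_⟩
  rotate_left
  · rw [sum_dixonTerm_closedForm (2 * m + 1) (p : ℚ_[p]) (by rw [hq]; push_cast; ring),
      Finset.prod_div_distrib, show 2 * m + 1 = m + 1 + m by ring, Finset.prod_range_add,
      Finset.prod_range_succ (fun j : ℕ => 4 * (j : ℚ_[p]) + 3), ← hq,
      show m + 1 + m = m + (m + 1) by ring]
    ring
  · have e1 : ∏ j ∈ Finset.range m, (4 * j + 3 : ZMod p) =
        (-1) ^ m * (4 ^ m * m.factorial) := by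
      rw [← Finset.prod_range_reflect]
      have : ∀ j ∈ Finset.range m, (4 * ((m - 1 - j : ℕ) : ZMod p) + 3) =
          (-1) * (4 * ((j + 1 : ℕ) : ZMod p)) := fun j hj => by
        rw [hr j hj]; push_cast; linear_combination hm
      rw [Finset.prod_congr rfl this, Finset.prod_mul_distrib, Finset.prod_mul_distrib,
        ← Nat.cast_prod, Finset.prod_range_add_one_eq_factorial]
      simp
    have e2 : ∏ j ∈ Finset.range m, (4 * ((m + 1 + j : ℕ) : ZMod p) + 3) =
        4 ^ m * m.factorial := by
      have : ∀ j ∈ Finset.range m, (4 * ((m + 1 + j : ℕ) : ZMod p) + 3) =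
          4 * ((j + 1 : ℕ) : ZMod p) := fun j hj => by
        push_cast; linear_combination hm
      rw [Finset.prod_congr rfl this, Finset.prod_mul_distrib,
        ← Nat.cast_prod, Finset.prod_range_add_one_eq_factorial]
      simp
    have e3 : ∏ j ∈ Finset.range (m + (m + 1)), (4 * j + 5 : ZMod p) =
        (-1) ^ m * (2 ^ m * ∏ j ∈ Finset.range m, (2 * j + 1 : ZMod p)) *
          (2 ^ m * (∏ j ∈ Finset.range m, (2 * j + 1 : ZMod p)) * (-1)) := by
      rw [Finset.prod_range_add, ← Finset.prod_range_reflect]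
      have t1 : ∀ j ∈ Finset.range m, (4 * ((m - 1 - j : ℕ) : ZMod p) + 5) =
          (-1) * (2 * (2 * j + 1)) := fun j hj => by
        rw [hr j hj]; linear_combination hm
      have t2 : ∀ j ∈ Finset.range (m + 1), (4 * ((m + j : ℕ) : ZMod p) + 5) =
          2 * (2 * j + 1) := fun j hj => by
        push_cast; linear_combination hm
      have t3 : (2 * (2 * m + 1) : ZMod p) = -1 := by linear_combination hm
      rw [Finset.prod_congr rfl t1, Finset.prod_congr rfl t2, Finset.prod_mul_distrib,
        Finset.prod_range_succ, t3, Finset.prod_mul_distrib]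
      simp
    rw [e3] at n5 ⊢
    rw [e1, e2]
    have h3 := prod_odd_mul_factorial (K := ZMod p) m
    have h5 := factorial_mul_factorial_zmod (p := p) (a := 2 * m + 1) (b := 2 * m + 1) (by omega)
    rw [Odd.neg_one_pow ⟨m, rfl⟩, Nat.factorial_succ] at h5
    push_cast at h5
    rw [← h3] at h5
    have hm' : (2 * m + 1 : ZMod p) = -1 / 2 := by
      rw [eq_div_iff h2]; linear_combination hm
    rw [hm'] at h5
    have h7 := two_pow_zmod hp
    rw [show p - 1 = m * 4 + 2 by omega, pow_add, pow_mul] at h7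
    have h16 : (16 : ZMod p) ≠ 0 := by
      rw [show (16 : ZMod p) = 2 ^ 4 by norm_num]; exact pow_ne_zero _ h2
    have hs : (-1 : ZMod p) ^ m ≠ 0 := pow_ne_zero _ (by simp)
    have ht : (2 : ZMod p) ^ m ≠ 0 := pow_ne_zero _ h2
    have h44 : (4 : ZMod p) ^ m = (2 ^ m) ^ 2 := by
      rw [← pow_mul, mul_comm, pow_mul]; norm_num
    rw [h44]
    rw [div_eq_div_iff h16 n5]
    field_simp at h5
    generalize (∏ j ∈ Finset.range m, (2 * j + 1 : ZMod p)) = P at *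
    generalize (2 : ZMod p) ^ m = t at *
    generalize (m.factorial : ZMod p) = f at *
    generalize (-1 : ZMod p) ^ m = s at *
    linear_combination -s * f ^ 2 * h5 - 4 * s * f ^ 2 * h7

end ClosedForms

/-! ### Assembly of the four congruences -/

section Main

variable {p n : ℕ} [Fact p.Prime]

theorem six_zmod_ne_zero (hp : 3 < p) : (6 : ZMod p) ≠ 0 := by
  have h3 : (3 : ZMod p) ≠ 0 := by
    exact_mod_cast natCast_zmod_ne_zero (p := p) (k := 3) (by omega) hp
  rw [show (6 : ZMod p) = 2 * 3 by norm_num]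
  exact mul_ne_zero (two_zmod_ne_zero (by omega)) h3

/-- If the closed form of the differentiated sum is `p * y` modulo `p ^ 2`, then so is the weighted
sum of `O_k`, up to a multiple of `p` computed modulo `p`. -/
theorem padicCongr_sum_oddSum_one (h : p = 2 * n + 1) (hp : 3 < p) {y g : ℚ_[p]} {z u : ZMod p}
    (hy : Reduces y z)
    (hD : PadicCongr p 2
      ((∑ k ∈ Finset.range (n + 1), dixonTerm (1 / 2) (1 / 2 + (p : ℚ_[p]) / 2) n k) *
        (2 / p + 6 * ∑ j ∈ Finset.range n, 1 / (4 * j + 3 : ℚ_[p]) -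
          2 * ∑ j ∈ Finset.range (n + 1), 1 / (4 * j + 1 : ℚ_[p]))) (p * y))
    (hg : Reduces g u)
    (hu : 6 * u = z - ((-1) ^ n + 1) *
      ∑ k ∈ Finset.range (n + 1), centralRatio (ZMod p) k ^ 3 * harmonicTwo (ZMod p) k) :
    PadicCongr p 2 (∑ k ∈ Finset.range (n + 1), centralRatio ℚ_[p] k ^ 3 * oddSum ℚ_[p] 1 k)
      (p * g) := by
  have h6 := six_zmod_ne_zero hp
  have hmain := (hD.symm.trans (padicCongr_six_mul_sum h hp)).symm
  have hb := reduces_sum_mul_oddSum h 2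
  have hh := reduces_sum_mul_harmonicTwo h
  have hr := sum_centralRatio_mul_oddSum_zmod h hp
  -- The second-order sums carry a factor p, so only their residues matter; reflection replaces 4 ∑
  -- c_k^3 O_k^{(2)} by -(-1)^n ∑ c_k^3 H_k^{(2)}.
  have h1 : Reduces (y + (4 * ∑ k ∈ Finset.range (n + 1), centralRatio ℚ_[p] k ^ 3 * oddSum ℚ_[p] 2 k -
      ∑ k ∈ Finset.range (n + 1), centralRatio ℚ_[p] k ^ 3 * harmonicTwo ℚ_[p] k)) (6 * u) :=
    (hy.add (((Reduces.ofNat 4).mul hb).sub hh)).congr (by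
      rw [hu]; linear_combination -hr)
  have h2 := (h1.padicCongr ((Reduces.ofNat 6).mul hg)).prime_mul
  have h3 := (hmain.add (PadicCongr.refl 2 ((p : ℚ_[p]) *
    (4 * ∑ k ∈ Finset.range (n + 1), centralRatio ℚ_[p] k ^ 3 * oddSum ℚ_[p] 2 k -
      ∑ k ∈ Finset.range (n + 1), centralRatio ℚ_[p] k ^ 3 * harmonicTwo ℚ_[p] k)))).trans (by
        rw [← mul_add]; exact h2)
  have h4 := PadicCongr.mul_left ((Reduces.ofNat (p := p) 6).inv h6).integral h3
  have h6' : (6 : ℚ_[p]) ≠ 0 := by norm_num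
  convert h4 using 1
  · change _ = (6 : ℚ_[p])⁻¹ * _
    rw [sub_add_cancel, inv_mul_cancel_left₀ h6']
  · change _ = (6 : ℚ_[p])⁻¹ * (p * (6 * g))
    field_simp

theorem truncatedSum_one_of_one (h4 : p % 4 = 1) (hp : 3 < p) :
    PadicCongr p 2 (truncatedSum p 1 : ℚ_[p]) 0 := by
  obtain ⟨m, h⟩ : ∃ m, p = 2 * (2 * m) + 1 := ⟨p / 4, by omega⟩
  have hp0 : (p : ℚ_[p]) ≠ 0 := by exact_mod_cast (Fact.out : p.Prime).ne_zero
  obtain ⟨y3, hy3, e3⟩ := exists_sum_four_mul_add_three h hp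
  obtain ⟨y1, hy1, e1⟩ := exists_sum_four_mul_add_one h hp
  have h8 := eight_zmod_ne_zero hp
  refine (padicCongr_truncatedSum h (by norm_num : 1 ≤ 3)).trans ?_
  rw [← mul_zero (p : ℚ_[p])]
  refine padicCongr_sum_oddSum_one h hp ((reduces_sum_dixonTerm h hp).mul
    (((Reduces.ofNat 6).mul hy3).sub ((Reduces.ofNat 2).mul hy1))) ?_ Reduces.zero ?_
  -- The poles 2/p and -2/p cancel, so this is an equality.
  · convert PadicCongr.refl (p := p) 2 _ using 1
    rw [e1, e3]
    field_simp
    ring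
  -- The main term is c_m^2 (6/8 + 2/8) H_m^{(2)} = c_m^2 H_m^{(2)}, exactly cancelled by 2 ∑ c_k^3
  -- H_k^{(2)}.
  · rw [sum_centralRatio_cube_zmod h hp, Even.neg_one_pow ⟨m, by ring⟩]
    have := sum_centralRatio_mul_harmonicTwo_even_zmod h hp
    field_simp
    linear_combination 8 * this

theorem truncatedSum_one_of_three (h4 : p % 4 = 3) (hp : 3 < p) :
    PadicCongr p 2 (truncatedSum p 1 : ℚ_[p])
      (-((p : ℚ_[p]) / 12) * (padicGamma p (PadicInt.inv 4) : ℚ_[p]) ^ 4) := by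
  obtain ⟨m, h⟩ : ∃ m, p = 2 * (2 * m + 1) + 1 := ⟨p / 4, by omega⟩
  have hp0 : (p : ℚ_[p]) ≠ 0 := by exact_mod_cast (Fact.out : p.Prime).ne_zero
  have h2 : (2 : ZMod p) ≠ 0 := two_zmod_ne_zero (by omega)
  have h6 := six_zmod_ne_zero hp
  have h12 : (12 : ZMod p) ≠ 0 := by
    rw [show (12 : ZMod p) = 2 * 6 by norm_num]; exact mul_ne_zero h2 h6
  have h16 : (16 : ZMod p) ≠ 0 := by
    rw [show (16 : ZMod p) = 2 ^ 4 by norm_num]; exact pow_ne_zero _ h2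
  obtain ⟨y, z, hy, ey⟩ := exists_sum_four_mul_add_of_three h hp
  obtain ⟨V, hV, eV⟩ := exists_sum_dixonTerm_of_three h hp
  have hG := reduces_padicGamma_pow_four_of_three h hp
  refine (padicCongr_truncatedSum h (by norm_num : 1 ≤ 3)).trans ?_
  rw [show (-((p : ℚ_[p]) / 12) * (padicGamma p (PadicInt.inv 4) : ℚ_[p]) ^ 4) =
    p * (-((padicGamma p (PadicInt.inv 4) : ℚ_[p]) ^ 4) / 12) by ring]
  refine padicCongr_sum_oddSum_one h hp ((Reduces.ofNat 8).mul hV) ?_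
    (hG.neg.div (Reduces.ofNat 12) h12) ?_
  · refine PadicCongr.of_sub_eq (hV.mul hy) ?_
    rw [eV, ey]
    change _ - (p : ℚ_[p]) * (8 * V) = _
    field_simp
    ring
  -- For odd n the coefficient (-1)^n + 1 is 0, so the second-order sums disappear and 8V alone
  -- remains.
  · rw [Odd.neg_one_pow ⟨m, rfl⟩]
    change 6 * (-(m.factorial : ZMod p) ^ 4 / 12) = 8 * (-(m.factorial : ZMod p) ^ 4 / 16) - _
    rw [show (12 : ZMod p) = 2 * 6 by norm_num] at *
    rw [show (16 : ZMod p) = 2 * 8 by norm_num] at *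
    have h8 := eight_zmod_ne_zero hp
    field_simp
    ring

theorem truncatedSum_two_of_one (h4 : p % 4 = 1) (hp : 3 < p) :
    PadicCongr p 1 (truncatedSum p 2 : ℚ_[p])
      (1 / 2 * (padicGamma p (PadicInt.inv 4) : ℚ_[p]) ^ 4 * (eulerNumber (p - 3) : ℚ_[p])) := by
  obtain ⟨m, h⟩ : ∃ m, p = 2 * (2 * m) + 1 := ⟨p / 4, by omega⟩
  have h2 : (2 : ZMod p) ≠ 0 := two_zmod_ne_zero (by omega)
  refine (padicCongr_truncatedSum h (by norm_num : 2 ≤ 3)).trans ?_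
  refine ((reduces_sum_mul_oddSum h 2).congr ?_).padicCongr
    (((Reduces.one.div (Reduces.ofNat 2) h2).mul (reduces_padicGamma_pow_four_of_one h hp)).mul
      (reduces_eulerNumber hp (p - 3)))
  have e1 := alternatingPowerSum_eq h hp
  have e2 := sum_centralRatio_mul_harmonicTwo_even_zmod h hp
  have e3 := sum_centralRatio_mul_oddSum_zmod h hp
  rw [Even.neg_one_pow ⟨m, by ring⟩] at e3
  have h8 := eight_zmod_ne_zero hp
  apply mul_left_cancel₀ h8
  change 8 * (1 / 2 * (-centralRatio (ZMod p) m ^ 2) * alternatingPowerSum p (p - 3)) = _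
  have e4 : (8 : ZMod p) * (1 / 2) = 4 := by field_simp; norm_num
  linear_combination (-centralRatio (ZMod p) m ^ 2 * alternatingPowerSum p (p - 3)) * e4 -
    centralRatio (ZMod p) m ^ 2 * e1 - 2 * e3 + e2

theorem truncatedSum_two_of_three (h4 : p % 4 = 3) (hp : 3 < p) :
    PadicCongr p 1 (truncatedSum p 2 : ℚ_[p])
      (-(1 / 16) * (padicGamma p (PadicInt.inv 4) : ℚ_[p]) ^ 4) := by
  obtain ⟨m, h⟩ : ∃ m, p = 2 * (2 * m + 1) + 1 := ⟨p / 4, by omega⟩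
  have h2 : (2 : ZMod p) ≠ 0 := two_zmod_ne_zero (by omega)
  have h16 : (16 : ZMod p) ≠ 0 := by
    rw [show (16 : ZMod p) = 2 ^ 4 by norm_num]; exact pow_ne_zero _ h2
  refine (padicCongr_truncatedSum h (by norm_num : 2 ≤ 3)).trans ?_
  refine ((reduces_sum_mul_oddSum h 2).congr ?_).padicCongr
    ((Reduces.one.div (Reduces.ofNat 16) h16).neg.mul (reduces_padicGamma_pow_four_of_three h hp))
  have e2 := sum_centralRatio_mul_harmonicTwo_odd_zmod h hp
  have e3 := sum_centralRatio_mul_oddSum_zmod h hp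
  rw [Odd.neg_one_pow ⟨m, rfl⟩] at e3
  apply mul_left_cancel₀ h16
  change 16 * (-(1 / 16) * (m.factorial : ZMod p) ^ 4) = _
  have e4 : (16 : ZMod p) * (1 / 16) = 1 := by field_simp
  linear_combination -(m.factorial : ZMod p) ^ 4 * e4 - 4 * e3 - e2

end Main

theorem mainTheorem3 (p : ℕ) [Fact p.Prime] (hp : 3 < p) :
    (p % 4 = 1 →
      PadicCongr p 2 (truncatedSum p 1 : ℚ_[p]) 0) ∧
    (p % 4 = 3 →
      PadicCongr p 2 (truncatedSum p 1 : ℚ_[p])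
        (-((p : ℚ_[p]) / 12) * (padicGamma p (PadicInt.inv 4) : ℚ_[p]) ^ 4)) ∧
    (p % 4 = 1 →
      PadicCongr p 1 (truncatedSum p 2 : ℚ_[p])
        (1 / 2 * (padicGamma p (PadicInt.inv 4) : ℚ_[p]) ^ 4 * (eulerNumber (p - 3) : ℚ_[p]))) ∧
    (p % 4 = 3 →
      PadicCongr p 1 (truncatedSum p 2 : ℚ_[p])
        (-(1 / 16) * (padicGamma p (PadicInt.inv 4) : ℚ_[p]) ^ 4)) := by
  exact ⟨fun h => truncatedSum_one_of_one h hp, fun h => truncatedSum_one_of_three h hp,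
    fun h => truncatedSum_two_of_one h hp, fun h => truncatedSum_two_of_three h hp⟩
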